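/- For complex numbers $b_1,b_2,b_3,b_4$ and $x>0$, Meijer's function $G^{20}_{04}$ is defined by the Mellin--Barnes integral $$G^{20}_{04}(x\mid b_1,b_2,b_3,b_4)=\frac1{2\pi i}\int_L\frac{\Gamma(b_1-\lambda)\Gamma(b_2-\lambda)}{\Gamma(1-b_3+\lambda)\Gamma(1-b_4+\lambda)}\,x^\lambda\,d\lambda,$$ where $L$ is a contour from $c-i\infty$ to $c+i\infty$, with $c\in\mathbb R$ and $c>\frac14(\operatorname{Re}(b_1+b_2+b_3+b_4)-1)$, that leaves all the points $b_1+k$, $b_2+k$ $(k=0,1,2,\dots)$ to the right; concretely, any polygonal path $c-i\infty\to c-iT\to s-iT\to s+iT\to c+iT\to c+i\infty$ with $s<\min(\operatorname{Re}b_1,\operatorname{Re}b_2)$ and $T>\max(|\operatorname{Im}b_1|,|\operatorname{Im}b_2|)$. **Plancherel formula for Meijer's $G$-transforms.** Let $b_1,b_2,\gamma\in\frac12\mathbb Z$ with $b_1\ge0$, $\gamma\ge1$ and $\frac{1-\gamma}2\le b_2\le\frac12+b_1$. Then the integral transform $$(S_{b_1,b_2,\gamma}f)(x)=\frac1\gamma\int_0^\infty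 G^{20}_{04}\bigl((xy)^{1/\gamma}\mid b_1,b_2,1-\gamma-b_1,1-\gamma-b_2\bigr)f(y)\,dy$$ is a unitary operator on $L^2(\mathbb R_+)=L^2((0,\infty),dx;\mathbb C)$. In particular $\|S_{b_1,b_2,\gamma}f\|_{L^2(\mathbb R_+)}=\|f\|_{L^2(\mathbb R_+)}$ for all $f\in L^2(\mathbb R_+)$. Here the integral is understood as usual for Plancherel-type transforms: for every $f\in L^2(\mathbb R_+)$ and $R>0$ the integral over $0<y\le R$ converges absolutely for all $x>0$ and is an $L^2$-function of $x$; as $R\to\infty$ these functions converge in $L^2(\mathbb R_+)$ to $S_{b_1,b_2,\gamma}f$; and $(S_{b_1,b_2,\gamma}f)(x)$ is given by the integral over $(0,\infty)$ at almost every $x>0$ at which that integral converges absolutely. -/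

import Mathlib

open MeasureTheory Set Filter Topology

noncomputable section

/-- The Mellin--Barnes integrand of `G^{20}_{04}(x | b₁, b₂, b₃, b₄)`. At the poles of the
denominator Mathlib's `Complex.Gamma` has the value `0`, so the quotient has its correct value `0`
there. -/
def meijerIntegrand (b₁ b₂ b₃ b₄ : ℂ) (x : ℝ) (z : ℂ) : ℂ :=
  Complex.Gamma (b₁ - z) * Complex.Gamma (b₂ - z) /
    (Complex.Gamma (1 - b₃ + z) * Complex.Gamma (1 - b₄ + z)) * (x : ℂ) ^ z

/-- An admissible contour for `G^{20}_{04}(· | b₁, b₂, b₃, b₄)`: the polygonal path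
`c - i∞ → c - iT → s - iT → s + iT → c + iT → c + i∞`.
It leaves all the poles `b₁ + k`, `b₂ + k` (`k = 0, 1, 2, …`) to the right, and the abscissa `c` of
its ends satisfies the convergence condition `c > (Re (b₁ + b₂ + b₃ + b₄) - 1) / 4`.
A vertical line is the case `s = c`. -/
structure MeijerContour (b₁ b₂ b₃ b₄ : ℂ) where
  c : ℝ
  s : ℝ
  T : ℝ
  lt_c : ((b₁ + b₂ + b₃ + b₄).re - 1) / 4 < c
  s_lt₁ : s < b₁.re
  s_lt₂ : s < b₂.re
  lt_T₁ : |b₁.im| < T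
  lt_T₂ : |b₂.im| < T

instance (b₁ b₂ b₃ b₄ : ℂ) : Nonempty (MeijerContour b₁ b₂ b₃ b₄) :=
  ⟨{ c := ((b₁ + b₂ + b₃ + b₄).re - 1) / 4 + 1
     s := min b₁.re b₂.re - 1
     T := max |b₁.im| |b₂.im| + 1
     lt_c := by linarith
     s_lt₁ := by linarith [min_le_left b₁.re b₂.re]
     s_lt₂ := by linarith [min_le_right b₁.re b₂.re]
     lt_T₁ := by linarith [le_max_left |b₁.im| |b₂.im|]
     lt_T₂ := by linarith [le_max_right |b₁.im| |b₂.im|] }⟩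

/-- The contour integral `∫_L F(z) dz`. -/
def MeijerContour.integral {b₁ b₂ b₃ b₄ : ℂ} (L : MeijerContour b₁ b₂ b₃ b₄) (F : ℂ → ℂ) : ℂ :=
  Complex.I * (∫ t in Iic (-L.T), F (L.c + t * Complex.I))
    + (∫ r in L.c..L.s, F (r - L.T * Complex.I))
    + Complex.I * (∫ t in (-L.T)..L.T, F (L.s + t * Complex.I))
    + (∫ r in L.s..L.c, F (r + L.T * Complex.I))
    + Complex.I * (∫ t in Ioi L.T, F (L.c + t * Complex.I))

/-- Meijer's function `G^{20}_{04}(x | b₁, b₂, b₃, b₄)` for `x > 0`, computed along the contour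
`L`. -/
def meijerG {b₁ b₂ b₃ b₄ : ℂ} (L : MeijerContour b₁ b₂ b₃ b₄) (x : ℝ) : ℂ :=
  1 / (2 * Real.pi * Complex.I) * L.integral (meijerIntegrand b₁ b₂ b₃ b₄ x)

/-- The Hilbert space `L²(ℝ₊)` of complex-valued functions, for Lebesgue measure on `(0, ∞)`. -/
abbrev L2Pos : Type := Lp ℂ 2 (volume.restrict (Ioi (0 : ℝ)))

/-- `S` is the transform `f ↦ ∫₀^∞ k(·, y) f(y) dy` on `L²(ℝ₊)`. For every `f ∈ L²(ℝ₊)`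
* the truncated integrals `∫₀^R k(x, y) f(y) dy` converge absolutely for all `x > 0`, define
  elements of `L²(ℝ₊)`, and converge to `S f` in the norm of `L²(ℝ₊)` as `R → ∞`;
* `(S f)(x) = ∫₀^∞ k(x, y) f(y) dy` at almost every point `x` at which the integral converges
  absolutely. -/
structure IsIntegralTransform (k : ℝ → ℝ → ℂ) (S : L2Pos → L2Pos) : Prop where
  integrableOn : ∀ f : L2Pos, ∀ R > (0 : ℝ), ∀ x > (0 : ℝ),
    IntegrableOn (fun y => k x y * f y) (Ioc 0 R)
  memLp : ∀ f : L2Pos, ∀ R > (0 : ℝ),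
    MemLp (fun x => ∫ y in Ioc 0 R, k x y * f y) 2 (volume.restrict (Ioi (0 : ℝ)))
  tendsto : ∀ f : L2Pos,
    Tendsto (fun R : ℝ => eLpNorm (fun x => (∫ y in Ioc 0 R, k x y * f y) - S f x) 2
      (volume.restrict (Ioi (0 : ℝ)))) atTop (𝓝 0)
  eq_integral : ∀ f : L2Pos, ∀ᵐ x ∂(volume.restrict (Ioi (0 : ℝ))),
    IntegrableOn (fun y => k x y * f y) (Ioi 0) → S f x = ∫ y in Ioi 0, k x y * f y

end

open scoped ENNReal

/-! With `β_j = b_j + γ/2` and `w = z + γ/2` the Mellin–Barnes quotient becomes symmetric: `Γ(β₁ -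
w) Γ(β₂ - w) / (Γ(β₁ + w) Γ(β₂ + w))`. For real `β_j > 0` numerator and denominator are complex
conjugates on the imaginary axis, so the quotient has modulus 1 there. After scaling `w = γ v` the
kernel is the inverse Mellin transform of `m(v)`, a function of `xy` alone. In logarithmic
coordinates the operator is therefore a reflected convolution whose Fourier multiplier is
unimodular: Plancherel makes it unitary.

The difficulty is that the inversion integral converges absolutely only to the right of the critical
line. The hypotheses give `β_j ≥ 1/2`, so `m` is holomorphic on `0 ≤ Re v ≤ 3/(8γ)`, and `m(v) =
O(|Im v| ^ (-4γ Re v))` is integrable on the right edge. The decay comes from comparing `|Γ(z)|`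
with `|Γ(z + p)|` (`exists_norm_Gamma_mul_rpow_le`), which replaces Stirling's formula.

The unitary operator `IsMellinMultiplier.transform` is built abstractly and then compared with the
integral on indicators of `(0, exp α]`. Their Mellin transform contributes a factor `1/(v + 1/2)`,
enough for integrability on every line `Re v = u > 0`; shifting the line and letting `u → 0` in `L²`
gives `coeFn_fourierInv_fourierSide_zero`. Density of the indicators and continuity of the truncated
integrals in `f` give the formula for all `f` (`isIntegralTransform_of_indicatorIoc`). -/

/-! ### Growth of the Gamma function under real translations. -/

lemma exp_le_one_add_mul_exp {y : ℝ} (hy : 0 ≤ y) :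
    Real.exp y ≤ (1 + y) * Real.exp (y ^ 2 / 2) := by
  have h1 : 2 * y / (y + 2) ≤ Real.log (1 + y) := Real.le_log_one_add_of_nonneg hy
  have h2 : y - y ^ 2 / 2 ≤ 2 * y / (y + 2) := by
    rw [le_div_iff₀ (by linarith)]
    nlinarith [pow_nonneg hy 3]
  calc Real.exp y ≤ Real.exp (Real.log (1 + y) + y ^ 2 / 2) := by
        apply Real.exp_le_exp.mpr; linarith
    _ = _ := by rw [Real.exp_add, Real.exp_log (by linarith)]

/-- Approximate log-concavity of `θ ↦ ‖z + θ‖`: interpolation between `θ = 0` and `θ = 1` fails only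
by a factor `exp (O(1 / (Re z)²))`, which is summable along `z, z + 1, z + 2, …`. -/
lemma norm_add_le_rpow_mul_exp {z : ℂ} (hz : 1 ≤ z.re) {θ : ℝ} (h0 : 0 ≤ θ) (h1 : θ ≤ 1) :
    ‖z + θ‖ ≤ ‖z‖ * (‖z + 1‖ / ‖z‖) ^ θ * Real.exp (9 / 4 / z.re ^ 2) := by
  have hzpos : 0 < ‖z‖ := by
    have := Complex.re_le_norm z
    linarith
  have hz1pos : 0 < ‖z + 1‖ := by
    have := Complex.re_le_norm (z + 1)
    simp at this
    linarith
  set D : ℝ := ‖z‖ ^ 2 with hD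
  have hDz : z.re ^ 2 ≤ D := by
    rw [hD, ← Complex.normSq_eq_norm_sq, Complex.normSq_apply]; nlinarith [sq_nonneg z.im]
  have hDpos : 0 < D := by positivity
  set y : ℝ := (2 * z.re + 1) / D with hy
  have hy0 : 0 ≤ y := by positivity
  have e1 : ‖z + 1‖ ^ 2 = D * (1 + y) := by
    rw [hy, mul_add, mul_div_cancel₀ _ hDpos.ne', hD, ← Complex.normSq_eq_norm_sq,
      ← Complex.normSq_eq_norm_sq, Complex.normSq_apply, Complex.normSq_apply]
    simp; ring
  -- Expanding the square, this is `θ² ≤ θ`.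
  have e2 : ‖z + θ‖ ^ 2 ≤ D * (1 + θ * y) := by
    rw [hy, mul_add, mul_left_comm, mul_div_cancel₀ _ hDpos.ne', hD, ← Complex.normSq_eq_norm_sq,
      ← Complex.normSq_eq_norm_sq, Complex.normSq_apply, Complex.normSq_apply]
    simp; nlinarith
  have hy3 : y ≤ 3 / z.re := by
    rw [hy, div_le_div_iff₀ hDpos (by linarith)]
    nlinarith
  have hy2 : y ^ 2 / 2 ≤ 9 / 2 / z.re ^ 2 := by
    have : y ^ 2 ≤ (3 / z.re) ^ 2 := by gcongr
    calc y ^ 2 / 2 ≤ (3 / z.re) ^ 2 / 2 := by gcongr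
      _ = _ := by ring
  have e3 : 1 + θ * y ≤ (1 + y) ^ θ * Real.exp (9 / 2 / z.re ^ 2) := by
    calc 1 + θ * y ≤ Real.exp (θ * y) := by linarith [Real.add_one_le_exp (θ * y)]
      _ = Real.exp y ^ θ := by rw [← Real.exp_mul, mul_comm]
      _ ≤ ((1 + y) * Real.exp (y ^ 2 / 2)) ^ θ :=
        Real.rpow_le_rpow (Real.exp_pos _).le (exp_le_one_add_mul_exp hy0) h0
      _ = (1 + y) ^ θ * Real.exp (y ^ 2 / 2) ^ θ :=
        Real.mul_rpow (by linarith) (Real.exp_pos _).le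
      _ ≤ (1 + y) ^ θ * Real.exp (9 / 2 / z.re ^ 2) := by
        gcongr
        rw [← Real.exp_mul]
        apply Real.exp_le_exp.mpr
        have : 0 ≤ y ^ 2 / 2 := by positivity
        nlinarith
  have e4 : (‖z + 1‖ / ‖z‖) ^ 2 = 1 + y := by
    rw [div_pow, e1, ← hD]; field_simp
  refine le_of_sq_le_sq ?_ (by positivity)
  calc ‖z + θ‖ ^ 2 ≤ D * (1 + θ * y) := e2
    _ ≤ D * ((1 + y) ^ θ * Real.exp (9 / 2 / z.re ^ 2)) := by gcongr
    _ = _ := by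
      have hexp : Real.exp (9 / 4 / z.re ^ 2) ^ 2 = Real.exp (9 / 2 / z.re ^ 2) := by
        rw [← Real.exp_nat_mul]
        congr 1
        push_cast
        ring
      have hpow : ((‖z + 1‖ / ‖z‖) ^ 2) ^ θ = ((‖z + 1‖ / ‖z‖) ^ θ) ^ 2 :=
        (Real.rpow_pow_comm (by positivity) θ 2).symm
      rw [← e4, mul_pow, mul_pow, ← hD, hexp, hpow]
      ring

/-- The interpolation factors `(‖z + j + 1‖ / ‖z + j‖) ^ θ` telescope, and the errors `9/4/(j + 1)²`
are dominated by the telescoping differences of `9/2/(j + 1)`. -/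
lemma prod_norm_add_le {z : ℂ} (hz : 1 ≤ z.re) {θ : ℝ} (h0 : 0 ≤ θ) (h1 : θ ≤ 1) (n : ℕ) :
    (∏ j ∈ Finset.range n, ‖z + θ + j‖) * ‖z‖ ^ θ ≤
      (∏ j ∈ Finset.range n, ‖z + j‖) * ‖z + n‖ ^ θ * Real.exp (9 / 2 - 9 / 2 / (n + 1)) := by
  induction n with
  | zero => simp
  | succ n ih =>
    have hre : 1 ≤ (z + n).re := by simp; linarith [(Nat.cast_nonneg n : (0 : ℝ) ≤ n)]
    have hpos : 0 < ‖z + n‖ := by linarith [Complex.re_le_norm (z + n)]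
    have key := norm_add_le_rpow_mul_exp hre h0 h1
    rw [Real.div_rpow (norm_nonneg _) (norm_nonneg _)] at key
    have hexp : 9 / 4 / (z + n).re ^ 2 ≤ 9 / 2 / ((n : ℝ) + 1) - 9 / 2 / (n + 1 + 1) := by
      have hn : (n : ℝ) + 1 ≤ (z + n).re := by simp; linarith
      have hn0 : (0 : ℝ) ≤ n := Nat.cast_nonneg n
      calc 9 / 4 / (z + n).re ^ 2 ≤ 9 / 4 / ((n : ℝ) + 1) ^ 2 := by gcongr
        _ ≤ _ := by
          rw [div_sub_div _ _ (by positivity) (by positivity), div_le_div_iff₀ (by positivity)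
            (by positivity)]
          nlinarith [mul_nonneg hn0 (sq_nonneg ((n : ℝ) + 1)), sq_nonneg ((n : ℝ) + 1)]
    rw [Finset.prod_range_succ, Finset.prod_range_succ]
    have e : z + θ + n = z + n + θ := by ring
    have hθpos : 0 < ‖z + n‖ ^ θ := Real.rpow_pos_of_pos hpos _
    calc (∏ j ∈ Finset.range n, ‖z + θ + j‖) * ‖z + θ + n‖ * ‖z‖ ^ θ
        = ((∏ j ∈ Finset.range n, ‖z + θ + j‖) * ‖z‖ ^ θ) * ‖z + n + θ‖ := by rw [e]; ring
      _ ≤ ((∏ j ∈ Finset.range n, ‖z + j‖) * ‖z + n‖ ^ θ * Real.exp (9 / 2 - 9 / 2 / (n + 1))) *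
          (‖z + n‖ * (‖z + n + 1‖ ^ θ / ‖z + n‖ ^ θ) * Real.exp (9 / 4 / (z + n).re ^ 2)) := by
          gcongr
      _ = (∏ j ∈ Finset.range n, ‖z + j‖) * ‖z + n‖ * ‖z + n + 1‖ ^ θ *
          Real.exp (9 / 2 - 9 / 2 / (n + 1) + 9 / 4 / (z + n).re ^ 2) := by
          rw [Real.exp_add]; field_simp
      _ ≤ _ := by
          push_cast
          rw [← add_assoc]
          gcongr
          linarith

/-- Euler's limit formula turns the bound on finite products into a bound on `Γ`. The factor `‖z + n
+ 1‖ ^ θ` from the products cancels asymptotically against the `n ^ θ` in Euler's sequence for `z +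
θ`. -/
lemma norm_Gamma_mul_rpow_le_of_one_le_re {z : ℂ} (hz : 1 ≤ z.re) {θ : ℝ} (h0 : 0 ≤ θ)
    (h1 : θ ≤ 1) : ‖Complex.Gamma z‖ * ‖z‖ ^ θ ≤ Real.exp (9 / 2) * ‖Complex.Gamma (z + θ)‖ := by
  have hlim : Tendsto (fun n : ℕ => (‖z + (n + 1 : ℕ)‖ / n) ^ θ) atTop (𝓝 1) := by
    have h : Tendsto (fun n : ℕ => ‖(z + 1) / (n : ℂ) + 1‖) atTop (𝓝 ‖(0 : ℂ) + 1‖) := by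
      refine (Tendsto.add_const _ ?_).norm
      exact tendsto_const_div_atTop_nhds_zero_nat _
    have h2 : Tendsto (fun n : ℕ => ‖z + (n + 1 : ℕ)‖ / n) atTop (𝓝 1) := by
      rw [zero_add, norm_one] at h
      refine h.congr' ?_
      filter_upwards [eventually_gt_atTop 0] with n hn
      have hn' : (n : ℂ) ≠ 0 := by exact_mod_cast hn.ne'
      rw [show (z + 1) / (n : ℂ) + 1 = (z + (n + 1 : ℕ)) / n by push_cast; field_simp; ring,
        norm_div, Complex.norm_natCast]
    simpa using h2.rpow_const (p := θ) (Or.inl one_ne_zero)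
  have hL := ((Complex.GammaSeq_tendsto_Gamma z).norm.mul_const (‖z‖ ^ θ))
  have hR := ((Complex.GammaSeq_tendsto_Gamma (z + θ)).norm.mul hlim).const_mul (Real.exp (9 / 2))
  rw [mul_one] at hR
  refine le_of_tendsto_of_tendsto hL hR ?_
  filter_upwards [eventually_gt_atTop 0] with n hn
  have hn' : (0 : ℝ) < n := by exact_mod_cast hn
  have hpos : ∀ j : ℕ, 0 < ‖z + j‖ := fun j => by
    have := Complex.re_le_norm (z + j)
    simp at this
    linarith [(Nat.cast_nonneg j : (0 : ℝ) ≤ j)]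
  have hpos' : ∀ j : ℕ, 0 < ‖z + θ + j‖ := fun j => by
    have := Complex.re_le_norm (z + θ + j)
    simp at this
    linarith [(Nat.cast_nonneg j : (0 : ℝ) ≤ j)]
  have hP : 0 < ∏ j ∈ Finset.range (n + 1), ‖z + j‖ := Finset.prod_pos fun j _ => hpos j
  have hP' : 0 < ∏ j ∈ Finset.range (n + 1), ‖z + θ + j‖ := Finset.prod_pos fun j _ => hpos' j
  have key := prod_norm_add_le hz h0 h1 (n + 1)
  have key' : (∏ j ∈ Finset.range (n + 1), ‖z + θ + j‖) * ‖z‖ ^ θ ≤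
      (∏ j ∈ Finset.range (n + 1), ‖z + j‖) * ‖z + (n + 1 : ℕ)‖ ^ θ * Real.exp (9 / 2) := by
    refine key.trans ?_
    gcongr
    have : (0 : ℝ) ≤ 9 / 2 / ((n + 1 : ℕ) + 1) := by positivity
    linarith
  simp only [Complex.GammaSeq, norm_div, norm_mul, norm_prod]
  rw [Complex.norm_natCast_cpow_of_pos hn, Complex.norm_natCast_cpow_of_pos hn,
    Complex.add_re, Complex.ofReal_re, Real.rpow_add hn', Real.div_rpow (norm_nonneg _) hn'.le]
  have hnθ : 0 < (n : ℝ) ^ θ := Real.rpow_pos_of_pos hn' _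
  have hnz : 0 < (n : ℝ) ^ z.re := Real.rpow_pos_of_pos hn' _
  rw [div_mul_eq_mul_div, div_le_iff₀ hP]
  have hne := hP'.ne'
  calc (n : ℝ) ^ z.re * ‖(n.factorial : ℂ)‖ * ‖z‖ ^ θ
      = (n : ℝ) ^ z.re * ‖(n.factorial : ℂ)‖ / (∏ j ∈ Finset.range (n + 1), ‖z + θ + j‖) *
        ((∏ j ∈ Finset.range (n + 1), ‖z + θ + j‖) * ‖z‖ ^ θ) := by field_simp
    _ ≤ (n : ℝ) ^ z.re * ‖(n.factorial : ℂ)‖ / (∏ j ∈ Finset.range (n + 1), ‖z + θ + j‖) *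
        ((∏ j ∈ Finset.range (n + 1), ‖z + j‖) * ‖z + (n + 1 : ℕ)‖ ^ θ * Real.exp (9 / 2)) := by
        gcongr
    _ = _ := by field_simp

lemma ne_zero_of_one_le_abs_im {z : ℂ} (hz : 1 ≤ |z.im|) : z ≠ 0 := by
  rintro rfl
  simp at hz
  linarith

/-- The functional equation moves the half-plane one unit to the left at the cost of `‖z + θ‖ / ‖z‖
≤ 2`. -/
lemma norm_Gamma_mul_rpow_le_of_le_one (k : ℕ) {z : ℂ} (hz : 1 - (k : ℝ) ≤ z.re)
    (him : 1 ≤ |z.im|) {θ : ℝ} (h0 : 0 ≤ θ) (h1 : θ ≤ 1) :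
    ‖Complex.Gamma z‖ * |z.im| ^ θ ≤ 2 ^ k * Real.exp (9 / 2) * ‖Complex.Gamma (z + θ)‖ := by
  induction k generalizing z with
  | zero =>
    simp only [Nat.cast_zero, sub_zero] at hz
    rw [pow_zero, one_mul]
    refine le_trans ?_ (norm_Gamma_mul_rpow_le_of_one_le_re hz h0 h1)
    gcongr
    exact Complex.abs_im_le_norm z
  | succ k ih =>
    have h := @ih (z + 1) (by push_cast at hz; simp; linarith) (by simpa using him)
    have hz0 := ne_zero_of_one_le_abs_im him
    have hθ0 : z + θ ≠ 0 := ne_zero_of_one_le_abs_im (by simpa using him)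
    rw [Complex.Gamma_add_one z hz0, show z + 1 + (θ : ℂ) = z + θ + 1 by ring,
      Complex.Gamma_add_one _ hθ0, norm_mul, norm_mul] at h
    have hz1 : 1 ≤ ‖z‖ := him.trans (Complex.abs_im_le_norm z)
    have h2 : ‖z + θ‖ ≤ 2 * ‖z‖ := by
      calc ‖z + θ‖ ≤ ‖z‖ + ‖(θ : ℂ)‖ := norm_add_le _ _
        _ ≤ ‖z‖ + 1 := by
          gcongr
          rwa [Complex.norm_real, Real.norm_of_nonneg h0]
        _ ≤ _ := by linarith
    have h3 : (z + 1).im = z.im := by simp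
    rw [h3] at h
    refine le_of_mul_le_mul_left ?_ (zero_lt_one.trans_le hz1)
    calc ‖z‖ * (‖Complex.Gamma z‖ * |z.im| ^ θ) = ‖z‖ * ‖Complex.Gamma z‖ * |z.im| ^ θ := by ring
      _ ≤ 2 ^ k * Real.exp (9 / 2) * (‖z + θ‖ * ‖Complex.Gamma (z + θ)‖) := h
      _ ≤ 2 ^ k * Real.exp (9 / 2) * (2 * ‖z‖ * ‖Complex.Gamma (z + θ)‖) := by gcongr
      _ = _ := by ring

lemma norm_Gamma_mul_pow_le (k : ℕ) (z : ℂ) (him : 1 ≤ |z.im|) :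
    ‖Complex.Gamma z‖ * |z.im| ^ k ≤ ‖Complex.Gamma (z + k)‖ := by
  induction k with
  | zero => simp
  | succ k ih =>
    have h0 : z + k ≠ 0 := ne_zero_of_one_le_abs_im (by simpa using him)
    have h1 : |z.im| ≤ ‖z + k‖ := by simpa using Complex.abs_im_le_norm (z + k)
    push_cast
    rw [← add_assoc, Complex.Gamma_add_one _ h0, norm_mul, pow_succ, ← mul_assoc, mul_comm]
    gcongr

/-- Quantitative growth of the Gamma function under real translations, uniformly in right
half-planes away from the real axis. -/
lemma exists_norm_Gamma_mul_rpow_le (A : ℝ) : ∃ C : ℝ, 0 < C ∧ ∀ z : ℂ, A ≤ z.re → 1 ≤ |z.im| →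
    ∀ p : ℝ, 0 ≤ p → ‖Complex.Gamma z‖ * |z.im| ^ p ≤ C * ‖Complex.Gamma (z + p)‖ := by
  obtain ⟨k, hk⟩ := exists_nat_ge (1 - A)
  refine ⟨2 ^ k * Real.exp (9 / 2), by positivity, fun z hz him p hp => ?_⟩
  -- Only the fractional part of `p` costs a constant; the integer part is handled by the functional
  -- equation with constant 1. Hence the constant does not depend on `p`.
  have hf0 : (0 : ℝ) ≤ p - ⌊p⌋₊ := sub_nonneg.mpr (Nat.floor_le hp)
  have hf1 : p - ⌊p⌋₊ ≤ 1 := by linarith [Nat.lt_floor_add_one p]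
  have h1 := norm_Gamma_mul_rpow_le_of_le_one k (by linarith) him hf0 hf1
  have h2 := norm_Gamma_mul_pow_le ⌊p⌋₊ (z + (p - ⌊p⌋₊ : ℝ)) (by simpa using him)
  have e1 : (z + (p - ⌊p⌋₊ : ℝ)).im = z.im := by simp
  have e2 : z + (p - ⌊p⌋₊ : ℝ) + ⌊p⌋₊ = z + p := by push_cast; ring
  rw [e1, e2] at h2
  have hpos : 0 < |z.im| := by linarith
  calc ‖Complex.Gamma z‖ * |z.im| ^ p
      = ‖Complex.Gamma z‖ * |z.im| ^ (p - ⌊p⌋₊) * |z.im| ^ ⌊p⌋₊ := by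
        rw [mul_assoc, ← Real.rpow_natCast, ← Real.rpow_add hpos]; congr 2; ring
    _ ≤ 2 ^ k * Real.exp (9 / 2) * ‖Complex.Gamma (z + (p - ⌊p⌋₊ : ℝ))‖ * |z.im| ^ ⌊p⌋₊ := by
        gcongr
    _ ≤ _ := by
        rw [mul_assoc]; gcongr

/-! ### Shifting vertical contours. -/

lemma continuous_vertical_line (a : ℝ) : Continuous fun t : ℝ => (a : ℂ) + t * Complex.I := by
  fun_prop

/-- A function continuous on `t ≥ T` and `O(t ^ (-p))` with `p > 1` is integrable on `t > T`. -/
lemma integrableOn_Ioi_of_le_rpow {f : ℝ → ℂ} {T C p : ℝ} (hp : 1 < p)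
    (hf : ContinuousOn f (Ici T)) (hb : ∀ t, T ≤ t → 1 ≤ t → ‖f t‖ ≤ C * t ^ (-p)) :
    IntegrableOn f (Ioi T) := by
  have h1 : IntegrableOn f (Icc T (max T 1)) :=
    (hf.mono Icc_subset_Ici_self).integrableOn_Icc
  have h2 : IntegrableOn f (Ioi (max T 1)) := by
    have hg : IntegrableOn (fun t : ℝ => C * t ^ (-p)) (Ioi (max T 1)) :=
      (integrableOn_Ioi_rpow_of_lt (by linarith) (by positivity)).const_mul C
    refine hg.mono' ?_ ?_
    · exact (hf.mono fun t ht => (le_max_left T 1).trans (mem_Ioi.mp ht).le).aestronglyMeasurable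
        measurableSet_Ioi
    · filter_upwards [ae_restrict_mem measurableSet_Ioi] with t ht
      exact hb t ((le_max_left T 1).trans (mem_Ioi.mp ht).le)
        ((le_max_right T 1).trans (mem_Ioi.mp ht).le)
  refine (h1.union h2).mono_set fun t ht => ?_
  rcases le_or_gt t (max T 1) with h | h
  · exact Or.inl ⟨(mem_Ioi.mp ht).le, h⟩
  · exact Or.inr h

/-- Moving the upper half of a vertical contour. -/
lemma integral_Ioi_vertical_shift {F : ℂ → ℂ} {a b T C p : ℝ} (hp : 1 < p)
    (hF : DifferentiableOn ℂ F {z | z.re ∈ uIcc a b ∧ T ≤ z.im})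
    (hb : ∀ z : ℂ, z.re ∈ uIcc a b → T ≤ z.im → 1 ≤ z.im → ‖F z‖ ≤ C * z.im ^ (-p)) :
    (∫ r in a..b, F (r + T * Complex.I)) + Complex.I * (∫ t in Ioi T, F (b + t * Complex.I)) =
      Complex.I * (∫ t in Ioi T, F (a + t * Complex.I)) := by
  have hint : ∀ c ∈ uIcc a b, IntegrableOn (fun t : ℝ => F (c + t * Complex.I)) (Ioi T) := by
    intro c hc
    refine integrableOn_Ioi_of_le_rpow (C := C) hp ?_ fun t hT h1 => ?_
    · refine hF.continuousOn.comp (continuous_vertical_line c).continuousOn fun t ht => ?_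
      simpa using ⟨hc, ht⟩
    · simpa using hb (c + t * Complex.I) (by simpa using hc) (by simpa using hT) (by simpa using h1)
  have hrect : ∀ᶠ Y : ℝ in atTop, (∫ r in a..b, F (r + T * Complex.I)) -
      (∫ r in a..b, F (r + Y * Complex.I)) + Complex.I * (∫ t in T..Y, F (b + t * Complex.I)) -
      Complex.I * (∫ t in T..Y, F (a + t * Complex.I)) = 0 := by
    filter_upwards [eventually_ge_atTop T] with Y hY
    have h := Complex.integral_boundary_rect_eq_zero_of_differentiableOn F (a + T * Complex.I)
      (b + Y * Complex.I) (hF.mono fun z hz => by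
        simp [Complex.mem_reProdIm, uIcc_of_le hY] at hz
        exact ⟨hz.1, hz.2.1⟩)
    simpa using h
  -- The far horizontal side of the rectangle has fixed length and a decaying integrand.
  have hhor : Tendsto (fun Y : ℝ => ∫ r in a..b, F (r + Y * Complex.I)) atTop (𝓝 0) := by
    have hz : Tendsto (fun Y : ℝ => C * Y ^ (-p) * |b - a|) atTop (𝓝 0) := by
      simpa using ((tendsto_rpow_neg_atTop (by linarith : 0 < p)).const_mul C).mul_const |b - a|
    refine squeeze_zero_norm' ?_ hz
    filter_upwards [eventually_ge_atTop T, eventually_ge_atTop 1] with Y hY h1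
    refine intervalIntegral.norm_integral_le_of_norm_le_const fun r hr => ?_
    simpa using hb (r + Y * Complex.I) (by simpa using uIoc_subset_uIcc hr) (by simpa using hY)
      (by simpa using h1)
  have hlim := ((tendsto_const_nhds (x := ∫ r in a..b, F (r + T * Complex.I))).sub hhor).add
    ((intervalIntegral_tendsto_integral_Ioi T (hint b right_mem_uIcc) tendsto_id).const_mul
      Complex.I)
  have hlim2 := hlim.sub
    ((intervalIntegral_tendsto_integral_Ioi T (hint a left_mem_uIcc) tendsto_id).const_mul
      Complex.I)
  have h0 := tendsto_nhds_unique (hlim2.congr' hrect) tendsto_const_nhds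
  linear_combination h0

/-- Moving the lower half of a vertical contour. -/
lemma integral_Iic_vertical_shift {F : ℂ → ℂ} {a b T C p : ℝ} (hp : 1 < p)
    (hF : DifferentiableOn ℂ F {z | z.re ∈ uIcc a b ∧ T ≤ -z.im})
    (hb : ∀ z : ℂ, z.re ∈ uIcc a b → T ≤ -z.im → 1 ≤ -z.im → ‖F z‖ ≤ C * (-z.im) ^ (-p)) :
    Complex.I * (∫ t in Iic (-T), F (b + t * Complex.I)) =
      Complex.I * (∫ t in Iic (-T), F (a + t * Complex.I)) +
        (∫ r in a..b, F (r - T * Complex.I)) := by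
  have hneg : ∀ {r : ℝ}, r ∈ uIcc (-b) (-a) → -r ∈ uIcc a b := fun {r} hr => by
    rw [mem_uIcc] at hr ⊢
    rcases hr with h | h
    · left; constructor <;> linarith
    · right; constructor <;> linarith
  -- The reflection `z ↦ -z` reduces the lower half to the upper one.
  have h := integral_Ioi_vertical_shift (F := fun z => F (-z)) (a := -b) (b := -a) (T := T) (C := C)
    hp (hF.comp differentiable_neg.differentiableOn fun z hz => by
      simpa using ⟨hneg hz.1, hz.2⟩)
    (fun z h1 h2 h3 => by
      simpa using hb (-z) (by simpa using hneg h1) (by simpa using h2) (by simpa using h3))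
  have e1 : ∀ c : ℝ, (∫ t in Ioi T, F (-(((-c : ℝ) : ℂ) + t * Complex.I))) =
      ∫ t in Iic (-T), F (c + t * Complex.I) := fun c => by
    rw [← integral_comp_neg_Ioi T (fun t : ℝ => F (c + t * Complex.I))]
    congr 1
    ext t
    push_cast
    ring_nf
  have e2 : (∫ r in (-b)..(-a), F (-((r : ℂ) + T * Complex.I))) =
      ∫ r in a..b, F (r - T * Complex.I) := by
    rw [← intervalIntegral.integral_comp_neg]
    congr 1
    ext t
    push_cast
    ring_nf
  rw [e1, e1, e2] at h
  linear_combination -h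

lemma integrable_vertical {F : ℂ → ℂ} {a C p : ℝ} (hp : 1 < p)
    (hF : ContinuousOn F {z | z.re = a})
    (hb : ∀ t : ℝ, 1 ≤ |t| → ‖F (a + t * Complex.I)‖ ≤ C * |t| ^ (-p)) :
    Integrable (fun t : ℝ => F (a + t * Complex.I)) := by
  have hc : Continuous (fun t : ℝ => F (a + t * Complex.I)) :=
    hF.comp_continuous (continuous_vertical_line a) (by simp)
  have h1 : IntegrableOn (fun t : ℝ => F (a + t * Complex.I)) (Ioi 0) :=
    integrableOn_Ioi_of_le_rpow hp hc.continuousOn fun t h0 h1 => by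
      simpa [abs_of_nonneg h0] using hb t (by simpa [abs_of_nonneg h0] using h1)
  have h2 : IntegrableOn (fun t : ℝ => F (a + t * Complex.I)) (Iic 0) := by
    have h : IntegrableOn (fun t : ℝ => F (a + (-t : ℝ) * Complex.I)) (Ioi 0) :=
      integrableOn_Ioi_of_le_rpow hp (hc.comp continuous_neg).continuousOn fun t h0 h1 => by
        simpa [abs_of_nonneg h0] using hb (-t) (by simpa [abs_of_nonneg h0] using h1)
    rw [← integrableOn_Ici_iff_integrableOn_Ioi] at h
    rw [← (Measure.measurePreserving_neg (volume : Measure ℝ)).integrableOn_comp_preimage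
      (Homeomorph.neg ℝ).measurableEmbedding]
    simpa [Function.comp_def] using h
  rw [← integrableOn_univ, ← Iic_union_Ioi (a := (0 : ℝ))]
  exact h2.union h1

/-- Moving a vertical line of integration. -/
lemma integral_vertical_shift {F : ℂ → ℂ} {a b C p : ℝ} (hp : 1 < p)
    (hF : DifferentiableOn ℂ F {z | z.re ∈ uIcc a b})
    (hb : ∀ z : ℂ, z.re ∈ uIcc a b → 1 ≤ |z.im| → ‖F z‖ ≤ C * |z.im| ^ (-p)) :
    (∫ t : ℝ, F (b + t * Complex.I)) = ∫ t : ℝ, F (a + t * Complex.I) := by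
  have hu := integral_Ioi_vertical_shift (T := 0) hp (hF.mono fun z hz => hz.1)
    (fun z h1 h2 h3 => by
      simpa [abs_of_nonneg h2] using hb z h1 (h3.trans (le_abs_self _)))
  have hl := integral_Iic_vertical_shift (T := 0) hp (hF.mono fun z hz => hz.1)
    (fun z h1 h2 h3 => by
      simpa [abs_of_nonpos (by linarith : z.im ≤ 0)] using hb z h1 (h3.trans (neg_le_abs _)))
  have hint : ∀ c ∈ uIcc a b, Integrable (fun t : ℝ => F (c + t * Complex.I)) := fun c hc =>
    integrable_vertical hp (hF.continuousOn.mono fun z (hz : z.re = c) => by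
      simpa [hz] using hc) fun t ht => by
        simpa using hb (c + t * Complex.I) (by simpa using hc) (by simpa using ht)
  simp only [neg_zero, Complex.ofReal_zero, zero_mul, add_zero, sub_zero] at hu hl
  rw [← integral_add_compl (measurableSet_Iic (a := (0 : ℝ))) (hint b right_mem_uIcc),
    ← integral_add_compl (measurableSet_Iic (a := (0 : ℝ))) (hint a left_mem_uIcc), compl_Iic]
  apply mul_left_cancel₀ Complex.I_ne_zero
  linear_combination hu + hl

/-- The integral along an admissible contour equals the integral along a vertical line. -/
lemma MeijerContour.integral_eq_vertical {b₁ b₂ b₃ b₄ : ℂ} (L : MeijerContour b₁ b₂ b₃ b₄)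
    {F : ℂ → ℂ} {d C p : ℝ} (hp : 1 < p)
    (hd : DifferentiableOn ℂ F {z | z.re ∈ uIcc d L.s})
    (hF : DifferentiableOn ℂ F {z | z.im ≠ 0})
    (hb : ∀ z : ℂ, z.re ∈ uIcc d L.c → 1 ≤ |z.im| → ‖F z‖ ≤ C * |z.im| ^ (-p)) :
    L.integral F = Complex.I * ∫ t : ℝ, F (d + t * Complex.I) := by
  have hT : 0 < L.T := (abs_nonneg _).trans_lt L.lt_T₁
  have hu := integral_Ioi_vertical_shift (T := L.T) hp
    (hF.mono fun z hz => (hT.trans_le hz.2).ne')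
    (fun z h1 h2 h3 => by
      simpa [abs_of_nonneg (hT.le.trans h2)] using hb z h1 (h3.trans (le_abs_self _)))
  have hl := integral_Iic_vertical_shift (T := L.T) hp
    (hF.mono fun z hz => (neg_pos.mp (hT.trans_le hz.2)).ne)
    (fun z h1 h2 h3 => by
      simpa [abs_of_nonpos (by linarith : z.im ≤ 0)] using hb z h1 (h3.trans (neg_le_abs _)))
  -- Only this rectangle, between `Re z = d` and `Re z = s`, meets the real axis, so holomorphy
  -- across the axis is needed there alone. The shifts to `Re z = c` stay at `|Im z| ≥ T`.
  have hr := Complex.integral_boundary_rect_eq_zero_of_differentiableOn F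
    (d - L.T * Complex.I) (L.s + L.T * Complex.I) (hd.mono fun z hz => by
      simp only [Complex.mem_reProdIm] at hz
      simpa using hz.1)
  have hint : Integrable (fun t : ℝ => F (d + t * Complex.I)) :=
    integrable_vertical hp (hd.continuousOn.mono fun z (hz : z.re = d) => by
      simp [hz]) fun t ht => by
        simpa using hb (d + t * Complex.I) (by simp) (by simpa using ht)
  have hsplit : (∫ t : ℝ, F (d + t * Complex.I)) = (∫ t in Iic (-L.T), F (d + t * Complex.I)) +
      (∫ t in (-L.T)..L.T, F (d + t * Complex.I)) + ∫ t in Ioi L.T, F (d + t * Complex.I) := by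
    rw [intervalIntegral.integral_of_le (by linarith), ← setIntegral_union
      (Iic_disjoint_Ioc le_rfl) measurableSet_Ioc hint.integrableOn hint.integrableOn,
      Iic_union_Ioc_eq_Iic (by linarith),
      ← integral_add_compl (measurableSet_Iic (a := L.T)) hint, compl_Iic]
  have hii : ∀ t : ℝ, t ≠ 0 → ∀ x y : ℝ,
      IntervalIntegrable (fun r : ℝ => F (r + t * Complex.I)) volume x y := by
    intro t ht x y
    refine ContinuousOn.intervalIntegrable ?_
    refine hF.continuousOn.comp (by fun_prop) fun r _ => ?_
    simpa using ht
  have hii' : ∀ x y : ℝ,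
      IntervalIntegrable (fun r : ℝ => F (r - L.T * Complex.I)) volume x y := fun x y => by
    simpa [sub_eq_add_neg] using hii (-L.T) (neg_ne_zero.mpr hT.ne') x y
  have a1 := intervalIntegral.integral_add_adjacent_intervals (hii' d L.c) (hii' L.c L.s)
  have a2 := intervalIntegral.integral_add_adjacent_intervals (hii L.T hT.ne' d L.s)
    (hii L.T hT.ne' L.s L.c)
  simp only [Complex.sub_re, Complex.add_re, Complex.ofReal_re, Complex.mul_re, Complex.I_re,
    mul_zero, Complex.ofReal_im, Complex.I_im, mul_one, sub_zero, Complex.sub_im, Complex.add_im,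
    Complex.mul_im, zero_add, add_zero, smul_eq_mul, sub_self, zero_sub, Complex.ofReal_neg,
    neg_mul, ← sub_eq_add_neg] at hr
  rw [MeijerContour.integral, hsplit]
  linear_combination hu + hl + hr + a1 + a2

/-! ### The inverse Fourier transform on `L¹ ∩ L²`. -/

open FourierTransform SchwartzMap in
/-- On `L¹ ∩ L²` the inverse Fourier transform of `L²` is given by the integral. -/
lemma coeFn_fourierInv_toLp {f : ℝ → ℂ} (hf : Integrable f) (hf2 : MemLp f 2) :
    ((𝓕⁻ (hf2.toLp f) : Lp ℂ 2 (volume : Measure ℝ)) : ℝ → ℂ) =ᵐ[volume] 𝓕⁻ f := by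
  have hcont : Continuous (𝓕⁻ f) := by
    rw [← Real.Lp.fourierTransformInv_toLp (memLp_one_iff_integrable.mpr hf)]
    exact (Real.Lp.fourierTransformInv _).continuous
  -- Both sides are compared as tempered distributions, tested on smooth compactly supported
  -- functions; the transform is moved onto the test function on each side.
  refine ae_eq_of_integral_contDiff_smul_eq
    ((Lp.memLp _).locallyIntegrable one_le_two) hcont.locallyIntegrable fun g hg hgc => ?_
  have hg₁ : HasCompactSupport (Complex.ofRealCLM ∘ g) := hgc.comp_left rfl
  have hg₂ : ContDiff ℝ ((⊤ : ℕ∞) : WithTop ℕ∞) (Complex.ofRealCLM ∘ g) := by fun_prop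
  set φ : 𝓢(ℝ, ℂ) := hg₁.toSchwartzMap hg₂ with hφ
  have hφ' : ∀ x, φ x = (g x : ℂ) := fun x => by simp [hφ]
  have h1 := congrArg (fun T => T φ) (Lp.fourierInv_toTemperedDistribution_eq (hf2.toLp f))
  simp only [TemperedDistribution.fourierInv_apply, Lp.toTemperedDistribution_apply] at h1
  have h2 : (∫ x, (𝓕⁻ φ) x • (hf2.toLp f) x) = ∫ x, (𝓕⁻ φ) x • f x := by
    refine integral_congr_ae ?_
    filter_upwards [hf2.coeFn_toLp] with x hx
    rw [hx]
  have h3 : (∫ x, (𝓕⁻ φ) x • f x) = ∫ x, φ x • (𝓕⁻ f) x := by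
    rw [SchwartzMap.fourierInv_coe]
    have := VectorFourier.integral_fourierIntegral_smul_eq_flip (μ := (volume : Measure ℝ))
      (ν := (volume : Measure ℝ)) (L := -innerₗ ℝ) (f := φ) (g := f) Real.continuous_fourierChar
      (by simp only [LinearMap.neg_apply, innerₗ_apply_apply]; fun_prop) φ.integrable hf
    have e : (-innerₗ ℝ).flip = -innerₗ ℝ := by
      ext
      simp
    rw [e] at this
    exact this
  rw [h2, h3] at h1
  calc (∫ x, g x • (𝓕⁻ (hf2.toLp f) : Lp ℂ 2 (volume : Measure ℝ)) x)
      = ∫ x, φ x • (𝓕⁻ (hf2.toLp f) : Lp ℂ 2 (volume : Measure ℝ)) x := by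
        simp only [hφ', Complex.real_smul, smul_eq_mul]
    _ = _ := h1.symm
    _ = _ := by simp only [hφ', Complex.real_smul, smul_eq_mul]

/-! ### Unitary weighted composition operators. -/

section WeightedComposition

variable {α β : Type*} [MeasurableSpace α] [MeasurableSpace β] {μ : Measure α} {ν : Measure β}

/-- The data of an isometric weighted composition operator `f ↦ w · (f ∘ φ)` from `L²(μ)` to
`L²(ν)`. -/
structure IsWeightedComp (μ : Measure α) (ν : Measure β) (w : β → ℂ) (φ : β → α) : Prop where
  measurable_weight : Measurable w
  measurable_map : Measurable φ
  weight_ne_zero : ∀ x, w x ≠ 0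
  map_eq : (ν.withDensity fun x => ‖w x‖ₑ ^ 2).map φ = μ

variable {w : β → ℂ} {φ : β → α}

/-- Since the weight never vanishes, `ν` and `‖w‖² ν` have the same null sets. -/
lemma IsWeightedComp.quasiMeasurePreserving (h : IsWeightedComp μ ν w φ) :
    Measure.QuasiMeasurePreserving φ ν μ := by
  refine ⟨h.measurable_map, ?_⟩
  refine Measure.AbsolutelyContinuous.mk fun s hs h0 => ?_
  have hm : Measurable fun x => ‖w x‖ₑ ^ 2 := h.measurable_weight.enorm.pow_const 2
  rw [← h.map_eq, Measure.map_apply h.measurable_map hs,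
    withDensity_apply_eq_zero hm] at h0
  rw [Measure.map_apply h.measurable_map hs]
  convert h0
  ext x
  simp [h.weight_ne_zero x]

lemma IsWeightedComp.eLpNorm_eq (h : IsWeightedComp μ ν w φ) {f : α → ℂ}
    (hf : AEStronglyMeasurable f μ) : eLpNorm (fun x => w x * f (φ x)) 2 ν = eLpNorm f 2 μ := by
  have hm : Measurable fun x => ‖w x‖ₑ ^ 2 := h.measurable_weight.enorm.pow_const 2
  have hf' : AEMeasurable (fun y => ‖f y‖ₑ ^ 2) ((ν.withDensity fun x => ‖w x‖ₑ ^ 2).map φ) := by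
    rw [h.map_eq]
    exact hf.enorm.pow_const 2
  have key : ∫⁻ x, ‖w x * f (φ x)‖ₑ ^ 2 ∂ν = ∫⁻ y, ‖f y‖ₑ ^ 2 ∂μ := by
    conv_rhs => rw [← h.map_eq]
    have e := lintegral_withDensity_eq_lintegral_mul₀' hm.aemeasurable
      (hf'.comp_measurable h.measurable_map)
    simp only [Function.comp_apply, Pi.mul_apply] at e
    rw [lintegral_map' hf' h.measurable_map.aemeasurable, e]
    simp only [enorm_mul, mul_pow]
  rw [eLpNorm_eq_lintegral_rpow_enorm_toReal two_ne_zero ENNReal.ofNat_ne_top,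
    eLpNorm_eq_lintegral_rpow_enorm_toReal two_ne_zero ENNReal.ofNat_ne_top]
  simp only [ENNReal.toReal_ofNat, ENNReal.rpow_ofNat]
  rw [key]

lemma IsWeightedComp.memLp (h : IsWeightedComp μ ν w φ) {f : α → ℂ} (hf : MemLp f 2 μ) :
    MemLp (fun x => w x * f (φ x)) 2 ν :=
  ⟨h.measurable_weight.aestronglyMeasurable.mul
    (hf.1.comp_quasiMeasurePreserving h.quasiMeasurePreserving),
    by rw [h.eLpNorm_eq hf.1]; exact hf.2⟩

/-- The isometry `f ↦ w · (f ∘ φ)` from `L²(μ)` to `L²(ν)`. -/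
noncomputable def IsWeightedComp.toLinearIsometry (h : IsWeightedComp μ ν w φ) :
    Lp ℂ 2 μ →ₗᵢ[ℂ] Lp ℂ 2 ν where
  toFun f := (h.memLp (Lp.memLp f)).toLp _
  map_add' f g := by
    rw [← MemLp.toLp_add]
    refine MemLp.toLp_congr _ _ ?_
    filter_upwards [h.quasiMeasurePreserving.ae (Lp.coeFn_add f g)] with x hx
    simp only [hx, Pi.add_apply, mul_add]
  map_smul' c f := by
    rw [RingHom.id_apply, ← MemLp.toLp_const_smul]
    refine MemLp.toLp_congr _ _ ?_
    filter_upwards [h.quasiMeasurePreserving.ae (Lp.coeFn_smul c f)] with x hx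
    simp only [hx, Pi.smul_apply, smul_eq_mul]
    ring
  norm_map' f := by
    change ‖(h.memLp (Lp.memLp f)).toLp _‖ = ‖f‖
    rw [Lp.norm_toLp, h.eLpNorm_eq (Lp.memLp f).1, Lp.norm_def]

lemma IsWeightedComp.coeFn_toLinearIsometry (h : IsWeightedComp μ ν w φ) (f : Lp ℂ 2 μ) :
    h.toLinearIsometry f =ᵐ[ν] fun x => w x * f (φ x) :=
  (h.memLp (Lp.memLp f)).coeFn_toLp

/-- Two mutually inverse weighted compositions define a unitary operator. -/
noncomputable def IsWeightedComp.toLinearIsometryEquiv (h : IsWeightedComp μ ν w φ) {w' : α → ℂ}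
    {φ' : α → β} (h' : IsWeightedComp ν μ w' φ')
    (hinv : ∀ x, φ' (φ x) = x ∧ w x * w' (φ x) = 1) : Lp ℂ 2 μ ≃ₗᵢ[ℂ] Lp ℂ 2 ν :=
  LinearIsometryEquiv.ofSurjective h.toLinearIsometry fun g =>
    ⟨h'.toLinearIsometry g, by
      apply Lp.ext
      filter_upwards [h.coeFn_toLinearIsometry (h'.toLinearIsometry g),
        h.quasiMeasurePreserving.ae (h'.coeFn_toLinearIsometry g)] with x h1 h2
      rw [h1, h2, (hinv x).1, ← mul_assoc, (hinv x).2, one_mul]⟩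

lemma IsWeightedComp.coeFn_toLinearIsometryEquiv (h : IsWeightedComp μ ν w φ) {w' : α → ℂ}
    {φ' : α → β} (h' : IsWeightedComp ν μ w' φ')
    (hinv : ∀ x, φ' (φ x) = x ∧ w x * w' (φ x) = 1) (f : Lp ℂ 2 μ) :
    h.toLinearIsometryEquiv h' hinv f =ᵐ[ν] fun x => w x * f (φ x) :=
  h.coeFn_toLinearIsometry f

lemma isWeightedComp_id {w : α → ℂ} (hw : Measurable w) (h1 : ∀ x, ‖w x‖ = 1) :
    IsWeightedComp μ μ w id where
  measurable_weight := hw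
  measurable_map := measurable_id
  weight_ne_zero x h := by simpa [h] using h1 x
  map_eq := by
    have : (fun x => ‖w x‖ₑ ^ 2) = fun _ => 1 := by
      ext x
      rw [← ofReal_norm, h1]
      simp
    rw [this, Measure.map_id]
    exact withDensity_one

/-- Multiplication by a unimodular function as a unitary operator on `L²`. -/
noncomputable def unimodularMul (μ : Measure α) {w : α → ℂ} (hw : Measurable w)
    (h1 : ∀ x, ‖w x‖ = 1) : Lp ℂ 2 μ ≃ₗᵢ[ℂ] Lp ℂ 2 μ :=
  (isWeightedComp_id hw h1).toLinearIsometryEquiv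
    (isWeightedComp_id (w := fun x => (w x)⁻¹) hw.inv fun x => by rw [norm_inv, h1, inv_one])
    fun x => ⟨rfl, mul_inv_cancel₀ fun h => by simpa [h] using h1 x⟩

lemma coeFn_unimodularMul {w : α → ℂ} (hw : Measurable w)
    (h1 : ∀ x, ‖w x‖ = 1) (f : Lp ℂ 2 μ) :
    unimodularMul μ hw h1 f =ᵐ[μ] fun x => w x * f x :=
  IsWeightedComp.coeFn_toLinearIsometryEquiv _ _ _ f

end WeightedComposition

/-! ### Logarithmic coordinates on the half-line. -/

/-- The weight is the square root of the Jacobian in `dx = exp t dt`. -/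
lemma isWeightedComp_exp : IsWeightedComp (volume.restrict (Ioi (0 : ℝ))) (volume : Measure ℝ)
    (fun t => (Real.exp (t / 2) : ℂ)) Real.exp where
  measurable_weight := by fun_prop
  measurable_map := Real.measurable_exp
  weight_ne_zero t := by exact_mod_cast (Real.exp_pos _).ne'
  map_eq := by
    ext s hs
    have hpre : MeasurableSet (Real.exp ⁻¹' s) := Real.measurable_exp hs
    have himg : Real.exp '' (Real.exp ⁻¹' s) = s ∩ Ioi 0 := by
      rw [image_preimage_eq_inter_range, Real.range_exp]
    rw [Measure.map_apply Real.measurable_exp hs, withDensity_apply _ hpre,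
      Measure.restrict_apply hs, ← himg, ← setLIntegral_one,
      lintegral_image_eq_lintegral_abs_deriv_mul hpre
        (fun x _ => (Real.hasDerivAt_exp x).hasDerivWithinAt) Real.exp_injective.injOn]
    refine lintegral_congr fun t => ?_
    rw [mul_one, ← ofReal_norm, Complex.norm_real, Real.norm_of_nonneg (Real.exp_pos _).le,
      abs_of_pos (Real.exp_pos _), ← ENNReal.ofReal_pow (Real.exp_pos _).le, ← Real.exp_nat_mul]
    congr 2
    push_cast
    ring

lemma isWeightedComp_log : IsWeightedComp (volume : Measure ℝ) (volume.restrict (Ioi (0 : ℝ)))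
    (fun x => (Real.exp (-(Real.log x / 2)) : ℂ)) Real.log where
  measurable_weight := by fun_prop
  measurable_map := Real.measurable_log
  weight_ne_zero t := by exact_mod_cast (Real.exp_pos _).ne'
  map_eq := by
    ext s hs
    have hpre : MeasurableSet (Real.log ⁻¹' s) := Real.measurable_log hs
    have himg : Real.log '' (Real.log ⁻¹' s ∩ Ioi 0) = s := by
      ext t
      constructor
      · rintro ⟨x, ⟨hx, -⟩, rfl⟩
        exact hx
      · intro ht
        exact ⟨Real.exp t, ⟨by simpa using ht, Real.exp_pos t⟩, Real.log_exp t⟩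
    conv_rhs => rw [← himg, ← setLIntegral_one]
    rw [Measure.map_apply Real.measurable_log hs, withDensity_apply _ hpre,
      Measure.restrict_restrict hpre,
      lintegral_image_eq_lintegral_abs_deriv_mul (hpre.inter measurableSet_Ioi)
        (fun x hx => (Real.hasDerivAt_log (ne_of_gt hx.2)).hasDerivWithinAt)
        (Real.log_injOn_pos.mono inter_subset_right)]
    refine setLIntegral_congr_fun (hpre.inter measurableSet_Ioi) fun x hx => ?_
    have hx0 : 0 < x := hx.2
    simp only [mul_one]
    rw [← ofReal_norm, Complex.norm_real, Real.norm_of_nonneg (Real.exp_pos _).le,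
      abs_of_pos (inv_pos.mpr hx0), ← ENNReal.ofReal_pow (Real.exp_pos _).le, ← Real.exp_nat_mul]
    congr 1
    rw [← Real.exp_log (inv_pos.mpr hx0), Real.log_inv]
    congr 1
    push_cast
    ring

/-- The unitary operator `f ↦ (t ↦ exp (t / 2) f (exp t))` from `L²(ℝ₊)` to `L²(ℝ)`. -/
noncomputable def logEquiv : L2Pos ≃ₗᵢ[ℂ] Lp ℂ 2 (volume : Measure ℝ) :=
  isWeightedComp_exp.toLinearIsometryEquiv isWeightedComp_log fun t => by
    refine ⟨Real.log_exp t, ?_⟩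
    rw [Real.log_exp, ← Complex.ofReal_mul, ← Real.exp_add, add_neg_cancel, Real.exp_zero,
      Complex.ofReal_one]

lemma coeFn_logEquiv (f : L2Pos) :
    logEquiv f =ᵐ[volume] fun t => (Real.exp (t / 2) : ℂ) * f (Real.exp t) :=
  IsWeightedComp.coeFn_toLinearIsometryEquiv _ _ _ f

/-! ### Integral transforms determined by indicator functions. -/

/-- A function integrable on `(0, N]` all of whose integrals over `(0, a]`, `a ≤ N`, vanish is zero
almost everywhere. -/
lemma ae_eq_zero_of_forall_integral_Ioc_eq_zero {h : ℝ → ℂ} {N : ℝ}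
    (hi : IntegrableOn h (Ioc 0 N)) (h0 : ∀ a, 0 < a → a ≤ N → ∫ y in Ioc 0 a, h y = 0) :
    ∀ᵐ y ∂(volume.restrict (Ioc 0 N)), h y = 0 := by
  have hIic : ∀ b : ℝ, ∫ y in Iic b, h y ∂(volume.restrict (Ioc 0 N)) = 0 := by
    intro b
    rw [Measure.restrict_restrict measurableSet_Iic, inter_comm, Ioc_inter_Iic]
    rcases le_or_gt (N ⊓ b) 0 with hb | hb
    · rw [Ioc_eq_empty (not_lt.mpr hb)]
      simp
    · exact h0 _ hb inf_le_left
  have htot : ∫ y, h y ∂(volume.restrict (Ioc 0 N)) = 0 := by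
    have := hIic N
    rwa [Measure.restrict_restrict measurableSet_Iic, inter_comm, Ioc_inter_Iic, inf_idem] at this
  refine Integrable.ae_eq_zero_of_forall_setIntegral_eq_zero hi fun s hs _ => ?_
  -- A π-λ argument on the half-lines `Iic b`; the vanishing total integral handles complements.
  induction s, hs using MeasurableSpace.induction_on_inter (borel_eq_generateFrom_Iic ℝ)
    isPiSystem_Iic with
  | empty => simp
  | basic t ht =>
    obtain ⟨b, rfl⟩ := ht
    exact hIic b
  | compl t ht ih =>
    have := integral_add_compl ht hi
    rw [htot, ih (measure_lt_top _ _), zero_add] at this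
    exact this
  | iUnion f hd hm ih =>
    rw [integral_iUnion hm hd hi.integrableOn]
    simp [ih _ (measure_lt_top _ _)]

/-- The indicator function of `(0, a]` as an element of `L²(ℝ₊)`. -/
noncomputable def indicatorIoc (a : ℝ) : L2Pos :=
  indicatorConstLp 2 (measurableSet_Ioc : MeasurableSet (Ioc 0 a))
    ((Measure.restrict_apply_le _ _).trans_lt measure_Ioc_lt_top).ne (1 : ℂ)

lemma coeFn_indicatorIoc (a : ℝ) :
    indicatorIoc a =ᵐ[volume.restrict (Ioi (0 : ℝ))] (Ioc 0 a).indicator fun _ => 1 :=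
  indicatorConstLp_coeFn

lemma restrict_Ioi_restrict_Ioc (a : ℝ) :
    ((volume : Measure ℝ).restrict (Ioi 0)).restrict (Ioc 0 a) = volume.restrict (Ioc 0 a) := by
  rw [Measure.restrict_restrict measurableSet_Ioc,
    inter_eq_left.mpr Ioc_subset_Ioi_self]

lemma L2Pos.memLp_restrict_Ioc (f : L2Pos) (R : ℝ) : MemLp f 2 (volume.restrict (Ioc 0 R)) := by
  rw [← restrict_Ioi_restrict_Ioc]
  exact (Lp.memLp f).restrict _

/-- A function orthogonal to all these indicators has vanishing integral over every `(0, a]`, hence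
is zero almost everywhere. -/
lemma span_indicatorIoc_dense :
    (Submodule.span ℂ (indicatorIoc '' Ioi 0)).topologicalClosure = ⊤ := by
  rw [Submodule.topologicalClosure_eq_top_iff, Submodule.eq_bot_iff]
  intro h hh
  have h0 : ∀ a, 0 < a → ∫ y in Ioc 0 a, h y = 0 := by
    intro a ha
    have := (Submodule.mem_orthogonal _ _).mp hh _
      (Submodule.subset_span (mem_image_of_mem indicatorIoc ha))
    rwa [indicatorIoc, L2.inner_indicatorConstLp_one, restrict_Ioi_restrict_Ioc] at this
  have hN : ∀ n : ℕ, ∀ᵐ y ∂(volume.restrict (Ioc 0 (n : ℝ))), h y = 0 := fun n =>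
    ae_eq_zero_of_forall_integral_Ioc_eq_zero
      ((L2Pos.memLp_restrict_Ioc h n).integrable one_le_two) fun a ha _ => h0 a ha
  rw [Lp.eq_zero_iff_ae_eq_zero]
  have hU : Ioi (0 : ℝ) = ⋃ n : ℕ, Ioc 0 (n : ℝ) := by
    ext y
    simp only [mem_Ioi, mem_iUnion, mem_Ioc, exists_and_left]
    exact ⟨fun hy => ⟨hy, exists_nat_ge y⟩, fun hy => hy.1⟩
  have hall := (ae_restrict_iUnion_iff (fun n : ℕ => Ioc 0 (n : ℝ)) (fun y => h y = 0)).mpr hN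
  rwa [← hU] at hall

/-- A bounded operator on `L²(ℝ₊)` which is given on indicator functions of intervals by pointwise
continuous functionals is given by them everywhere. -/
lemma ae_eq_of_indicatorIoc (A : L2Pos →L[ℂ] L2Pos) (l : ℝ → L2Pos →L[ℂ] ℂ)
    (hA : ∀ a > 0, A (indicatorIoc a) =ᵐ[volume.restrict (Ioi (0 : ℝ))]
      fun x => l x (indicatorIoc a)) (h : L2Pos) :
    A h =ᵐ[volume.restrict (Ioi (0 : ℝ))] fun x => l x h := by
  let V : Submodule ℂ L2Pos :=
    { carrier := {h | A h =ᵐ[volume.restrict (Ioi (0 : ℝ))] fun x => l x h}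
      add_mem' := by
        intro f g hf hg
        simp only [mem_ofPred_eq, map_add]
        filter_upwards [hf, hg, Lp.coeFn_add (A f) (A g)] with x h1 h2 h3
        rw [h3, Pi.add_apply, h1, h2]
      zero_mem' := by
        simp only [mem_ofPred_eq, map_zero]
        exact Lp.coeFn_zero _ _ _
      smul_mem' := by
        intro c f hf
        simp only [mem_ofPred_eq, map_smul]
        filter_upwards [hf, Lp.coeFn_smul c (A f)] with x h1 h3
        rw [h3, Pi.smul_apply, h1] }
  have hV : IsClosed (V : Set L2Pos) := by
    refine IsSeqClosed.isClosed fun f g hf hg => ?_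
    have hAf : Tendsto (fun n => A (f n)) atTop (𝓝 (A g)) := (A.continuous.tendsto g).comp hg
    -- An `L²` limit is an almost everywhere limit along a subsequence, and continuity of each `l x`
    -- identifies that limit.
    obtain ⟨φ, hφ, hae⟩ := (tendstoInMeasure_of_tendsto_Lp hAf).exists_seq_tendsto_ae
    change A g =ᵐ[volume.restrict (Ioi (0 : ℝ))] fun x => l x g
    filter_upwards [hae, ae_all_iff.mpr hf] with x h1 h2
    refine tendsto_nhds_unique h1 ?_
    simp only [h2]
    exact (((l x).continuous.tendsto g).comp hg).comp hφ.tendsto_atTop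
  have htop : (⊤ : Submodule ℂ L2Pos) ≤ V := by
    rw [← span_indicatorIoc_dense]
    refine Submodule.topologicalClosure_minimal _ (Submodule.span_le.mpr ?_) hV
    rintro _ ⟨a, ha, rfl⟩
    exact hA a ha
  exact htop (Submodule.mem_top (x := h))

/-- The truncation `f ↦ 1_{(0, R]} f` on `L²(ℝ₊)`. -/
noncomputable def truncateIoc (R : ℝ) : L2Pos →L[ℂ] L2Pos :=
  LinearMap.mkContinuous
    { toFun := fun f => ((Lp.memLp f).indicator (measurableSet_Ioc : MeasurableSet (Ioc 0 R))).toLp _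
      map_add' := fun f g => by
        rw [← MemLp.toLp_add]
        refine MemLp.toLp_congr _ _ ?_
        filter_upwards [Lp.coeFn_add f g] with x hx
        by_cases hR : x ∈ Ioc 0 R
        · simpa only [Pi.add_apply, indicator_of_mem hR] using hx
        · simp [hR]
      map_smul' := fun c f => by
        rw [RingHom.id_apply, ← MemLp.toLp_const_smul]
        refine MemLp.toLp_congr _ _ ?_
        filter_upwards [Lp.coeFn_smul c f] with x hx
        by_cases hR : x ∈ Ioc 0 R
        · simpa only [Pi.smul_apply, indicator_of_mem hR] using hx
        · simp [hR] } 1 fun f => by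
    rw [one_mul]
    refine Lp.norm_le_norm_of_ae_le ?_
    filter_upwards [((Lp.memLp f).indicator
      (measurableSet_Ioc : MeasurableSet (Ioc 0 R))).coeFn_toLp] with x hx
    rw [LinearMap.coe_mk, AddHom.coe_mk, hx]
    exact norm_indicator_le_norm_self _ _

lemma coeFn_truncateIoc (R : ℝ) (f : L2Pos) :
    truncateIoc R f =ᵐ[volume.restrict (Ioi (0 : ℝ))] (Ioc 0 R).indicator f :=
  ((Lp.memLp f).indicator (measurableSet_Ioc : MeasurableSet (Ioc 0 R))).coeFn_toLp

lemma truncateIoc_indicatorIoc (R a : ℝ) :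
    truncateIoc R (indicatorIoc a) = indicatorIoc (min a R) := by
  apply Lp.ext
  filter_upwards [coeFn_truncateIoc R (indicatorIoc a), coeFn_indicatorIoc a,
    coeFn_indicatorIoc (min a R)] with x h1 h2 h3
  rw [h1, h3, show Ioc 0 (min a R) = Ioc 0 R ∩ Ioc 0 a by rw [Ioc_inter_Ioc, inf_comm]; simp,
    ← indicator_indicator]
  by_cases hR : x ∈ Ioc 0 R
  · rw [indicator_of_mem hR, indicator_of_mem hR, h2]
  · rw [indicator_of_notMem hR, indicator_of_notMem hR]

/-- Dominated convergence in `L²`. -/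
lemma tendsto_eLpNorm_two_of_dominated {α : Type*} [MeasurableSpace α] {μ : Measure α}
    {F : ℕ → α → ℂ} {f : α → ℂ} {g : α → ℝ}
    (hg : MemLp g 2 μ) (hF : ∀ n, AEStronglyMeasurable (F n) μ)
    (hf : AEStronglyMeasurable f μ) (hb : ∀ n, ∀ᵐ x ∂μ, ‖F n x‖ ≤ g x)
    (hfb : ∀ᵐ x ∂μ, ‖f x‖ ≤ g x) (hlim : ∀ᵐ x ∂μ, Tendsto (fun n => F n x) atTop (𝓝 (f x))) :
    Tendsto (fun n => eLpNorm (F n - f) 2 μ) atTop (𝓝 0) := by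
  have h2 : Tendsto (fun n => ∫⁻ x, ‖F n x - f x‖ₑ ^ 2 ∂μ) atTop (𝓝 (∫⁻ _, 0 ∂μ)) := by
    refine tendsto_lintegral_of_dominated_convergence' (fun x => ‖2 * g x‖ₑ ^ 2) ?_ ?_ ?_ ?_
    · exact fun n => ((hF n).sub hf).enorm.pow_const 2
    · intro n
      filter_upwards [hb n, hfb] with x h1 h2
      gcongr
      rw [enorm_le_iff_norm_le]
      refine (norm_sub_le _ _).trans (le_trans ?_ (le_abs_self _))
      linarith
    · have := (hg.const_mul 2).eLpNorm_lt_top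
      rw [eLpNorm_lt_top_iff_lintegral_rpow_enorm_lt_top two_ne_zero ENNReal.ofNat_ne_top] at this
      simpa using this.ne
    · filter_upwards [hlim] with x hx
      have h0 : Tendsto (fun n => F n x - f x) atTop (𝓝 0) := by simpa using hx.sub_const (f x)
      have h1 := h0.enorm
      rw [enorm_zero] at h1
      have h3 := ((ENNReal.continuous_pow 2).tendsto 0).comp h1
      simpa [Function.comp_def] using h3
  rw [lintegral_zero] at h2
  have h3 := ((ENNReal.continuous_rpow_const (y := 1 / 2)).tendsto 0).comp h2
  rw [ENNReal.zero_rpow_of_pos (by norm_num)] at h3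
  refine h3.congr fun n => ?_
  rw [eLpNorm_eq_lintegral_rpow_enorm_toReal two_ne_zero ENNReal.ofNat_ne_top]
  simp

lemma tendsto_truncateIoc (f : L2Pos) : Tendsto (fun R => truncateIoc R f) atTop (𝓝 f) := by
  refine tendsto_of_seq_tendsto fun R hR => ?_
  rw [Lp.tendsto_Lp_iff_tendsto_eLpNorm']
  refine tendsto_eLpNorm_two_of_dominated (g := fun x => ‖f x‖) (Lp.memLp f).norm
    (fun n => (Lp.memLp _).1) (Lp.memLp f).1
    (fun n => ?_) (Eventually.of_forall fun x => le_rfl) ?_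
  · filter_upwards [coeFn_truncateIoc (R n) f] with x hx
    rw [Function.comp_apply, hx]
    exact norm_indicator_le_norm_self _ _
  · filter_upwards [ae_all_iff.mpr fun n => coeFn_truncateIoc (R n) f,
      ae_restrict_mem measurableSet_Ioi] with x hx hx0
    refine tendsto_const_nhds.congr' ?_
    filter_upwards [hR.eventually_ge_atTop x] with n hn
    rw [Function.comp_apply, hx n, indicator_of_mem (show x ∈ Ioc 0 (R n) from ⟨hx0, hn⟩)]

/-- For fixed `x > 0` the integral over `(0, R]` is an inner product with a locally
square-integrable kernel, hence continuous in `f`. The truncated formula therefore extends from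
indicators to all of `L²`, and letting `R → ∞` uses only the continuity of `S`. -/
lemma isIntegralTransform_of_indicatorIoc {k : ℝ → ℝ → ℂ} (S : L2Pos ≃ₗᵢ[ℂ] L2Pos)
    (hk : ∀ x > 0, ∀ R > 0, MemLp (k x) 2 (volume.restrict (Ioc 0 R)))
    (hS : ∀ a > 0, S (indicatorIoc a) =ᵐ[volume.restrict (Ioi (0 : ℝ))]
      fun x => ∫ y in Ioc 0 a, k x y) :
    IsIntegralTransform k S := by
  have hint : ∀ f : L2Pos, ∀ R > (0 : ℝ), ∀ x > (0 : ℝ),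
      IntegrableOn (fun y => k x y * f y) (Ioc 0 R) := fun f R hR x hx =>
    (hk x hx R hR).integrable_mul (L2Pos.memLp_restrict_Ioc f R)
  have hfun : ∀ R > (0 : ℝ), ∀ x : ℝ, ∃ l : L2Pos →L[ℂ] ℂ, 0 < x →
      ∀ f : L2Pos, ∫ y in Ioc 0 R, k x y * f y = l f := by
    intro R hR x
    by_cases hx : 0 < x
    swap
    · exact ⟨0, fun h => absurd h hx⟩
    have hm : MemLp ((Ioc 0 R).indicator fun y => starRingEnd ℂ (k x y)) 2
        (volume.restrict (Ioi (0 : ℝ))) := by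
      rw [memLp_indicator_iff_restrict measurableSet_Ioc, restrict_Ioi_restrict_Ioc]
      exact (hk x hx R hR).star
    refine ⟨innerSL ℂ (hm.toLp _), fun _ f => ?_⟩
    rw [innerSL_apply_apply, L2.inner_def, ← restrict_Ioi_restrict_Ioc,
      ← integral_indicator measurableSet_Ioc]
    refine integral_congr_ae ?_
    filter_upwards [hm.coeFn_toLp] with y hy
    rw [hy]
    by_cases hR : y ∈ Ioc 0 R <;> simp [hR, mul_comm]
  have htr : ∀ f : L2Pos, ∀ R > (0 : ℝ),
      S (truncateIoc R f) =ᵐ[volume.restrict (Ioi (0 : ℝ))]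
        fun x => ∫ y in Ioc 0 R, k x y * f y := by
    intro f R hR
    choose l hl using hfun R hR
    have := ae_eq_of_indicatorIoc
      ((S.toContinuousLinearEquiv : L2Pos →L[ℂ] L2Pos).comp (truncateIoc R)) l (fun a ha => ?_) f
    · filter_upwards [this, ae_restrict_mem measurableSet_Ioi] with x h1 hx
      rw [hl x hx f]
      exact h1
    -- Truncating an indicator gives another indicator, so the hypothesis on `S` applies directly.
    · have h1 := hS (min a R) (lt_min ha hR)
      filter_upwards [h1, ae_restrict_mem measurableSet_Ioi] with x h2 hx
      rw [← hl x hx]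
      change S (truncateIoc R (indicatorIoc a)) x = _
      have h3 : ∀ᵐ y ∂(volume.restrict (Ioc 0 R)),
          indicatorIoc a y = (Ioc 0 a).indicator (fun _ => (1 : ℂ)) y :=
        ae_mono (Measure.restrict_mono Ioc_subset_Ioi_self le_rfl) (coeFn_indicatorIoc a)
      have h4 : (∫ y in Ioc 0 R, k x y * indicatorIoc a y) =
          ∫ y in Ioc 0 R, (Ioc 0 a).indicator (k x) y := by
        refine integral_congr_ae ?_
        filter_upwards [h3] with y hy
        rw [hy]
        by_cases hya : y ∈ Ioc 0 a <;> simp [hya]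
      rw [truncateIoc_indicatorIoc, h2, h4, setIntegral_indicator measurableSet_Ioc, Ioc_inter_Ioc,
        inf_comm, sup_idem]
  have htend : ∀ f : L2Pos,
    Tendsto (fun R : ℝ => eLpNorm (fun x => (∫ y in Ioc 0 R, k x y * f y) - S f x) 2
      (volume.restrict (Ioi (0 : ℝ)))) atTop (𝓝 0) := by
    intro f
    have h1 : Tendsto (fun R => S (truncateIoc R f)) atTop (𝓝 (S f)) :=
      (S.continuous.tendsto f).comp (tendsto_truncateIoc f)
    rw [Lp.tendsto_Lp_iff_tendsto_eLpNorm'] at h1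
    refine h1.congr' ?_
    filter_upwards [eventually_gt_atTop 0] with R hR
    refine eLpNorm_congr_ae ?_
    filter_upwards [htr f R hR] with x hx
    rw [Pi.sub_apply, hx]
  refine ⟨hint, fun f R hR => (memLp_congr_ae (htr f R hR)).mp (Lp.memLp _), htend, fun f => ?_⟩
  -- Along a subsequence of `R = n + 1 > 0` the truncated integrals converge almost everywhere to `S
  -- f`; where the full integral converges absolutely they also converge to it.
  have h1 : Tendsto (fun n : ℕ => S (truncateIoc (n + 1 : ℝ) f)) atTop (𝓝 (S f)) :=
    (S.continuous.tendsto f).comp ((tendsto_truncateIoc f).comp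
      (tendsto_atTop_add_const_right _ _ tendsto_natCast_atTop_atTop))
  obtain ⟨φ, hφ, hae⟩ := (tendstoInMeasure_of_tendsto_Lp h1).exists_seq_tendsto_ae
  filter_upwards [hae, ae_all_iff.mpr fun n : ℕ => htr f (n + 1 : ℝ) (by positivity)] with x h2 h3 h4
  refine tendsto_nhds_unique h2 ?_
  simp only [h3]
  have h5 := (intervalIntegral_tendsto_integral_Ioi 0 h4
    (tendsto_atTop_add_const_right _ (1 : ℝ) tendsto_natCast_atTop_atTop)).comp hφ.tendsto_atTop
  refine h5.congr fun n => ?_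
  rw [Function.comp_apply, intervalIntegral.integral_of_le (by positivity)]

/-! ### Mellin multipliers and their integral kernels. -/

/-- A holomorphic multiplier on the strip `0 ≤ Re v ≤ ε` which is unimodular on the imaginary axis
and decays like `|Im v| ^ (-q Re v)` in the strip, integrably so on the line `Re v = ε`. -/
structure IsMellinMultiplier (m : ℂ → ℂ) (ε q C : ℝ) : Prop where
  pos : 0 < ε
  one_lt : 1 < q * ε
  differentiableOn : DifferentiableOn ℂ m {v | 0 ≤ v.re ∧ v.re ≤ ε}
  norm_le : ∀ v : ℂ, 0 ≤ v.re → v.re ≤ ε → ‖m v‖ ≤ C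
  norm_le_rpow : ∀ v : ℂ, 0 ≤ v.re → v.re ≤ ε → 1 ≤ |v.im| → ‖m v‖ ≤ C * |v.im| ^ (-(q * v.re))
  norm_imaginary : ∀ t : ℝ, ‖m (t * Complex.I)‖ = 1

/-- The inverse Mellin transform of `m` along `Re v = ε`, in logarithmic coordinates. -/
noncomputable def logKernel (m : ℂ → ℂ) (ε s : ℝ) : ℂ :=
  (2 * Real.pi : ℂ)⁻¹ * ∫ τ : ℝ, m (ε + τ * Complex.I) *
    Complex.exp ((ε + τ * Complex.I - 1 / 2) * s)

namespace IsMellinMultiplier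

variable {m : ℂ → ℂ} {ε q C : ℝ}

lemma nonneg (h : IsMellinMultiplier m ε q C) : 0 ≤ C :=
  (norm_nonneg _).trans (h.norm_le 0 (by simp) (by simpa using h.pos.le))

lemma q_pos (h : IsMellinMultiplier m ε q C) : 0 < q := by
  have := h.one_lt
  have := h.pos
  by_contra hq
  nlinarith

lemma continuous_vertical (h : IsMellinMultiplier m ε q C) {u : ℝ} (h0 : 0 ≤ u) (h1 : u ≤ ε) :
    Continuous fun τ : ℝ => m (u + τ * Complex.I) :=
  h.differentiableOn.continuousOn.comp_continuous (continuous_vertical_line u)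
    fun τ => by simpa using ⟨h0, h1⟩

lemma integrable_line (h : IsMellinMultiplier m ε q C) :
    Integrable fun τ : ℝ => m (ε + τ * Complex.I) := by
  refine integrable_vertical (C := C) h.one_lt (h.differentiableOn.continuousOn.mono ?_) fun t ht => ?_
  · rintro v hv
    have hv' : v.re = ε := hv
    exact ⟨hv' ▸ h.pos.le, hv'.le⟩
  · simpa using h.norm_le_rpow (ε + t * Complex.I) (by simpa using h.pos.le) (by simp)
      (by simpa using ht)

lemma norm_logKernel_le (m : ℂ → ℂ) (ε s : ℝ) : ‖logKernel m ε s‖ ≤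
    (2 * Real.pi)⁻¹ * (∫ τ : ℝ, ‖m (ε + τ * Complex.I)‖) * Real.exp ((ε - 1 / 2) * s) := by
  rw [logKernel, norm_mul, mul_assoc]
  have e : ‖(2 * Real.pi : ℂ)⁻¹‖ = (2 * Real.pi)⁻¹ := by
    rw [norm_inv, norm_mul, Complex.norm_real, Real.norm_of_nonneg Real.pi_pos.le]
    simp
  rw [e]
  gcongr
  refine (norm_integral_le_integral_norm _).trans_eq ?_
  rw [← integral_mul_const]
  congr 1
  ext τ
  rw [norm_mul, Complex.norm_exp]
  simp

lemma measurable_logKernel (h : IsMellinMultiplier m ε q C) : Measurable (logKernel m ε) := by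
  have hm := h.continuous_vertical h.pos.le le_rfl
  have : Continuous (Function.uncurry fun (s τ : ℝ) => m (ε + τ * Complex.I) *
      Complex.exp ((ε + τ * Complex.I - 1 / 2) * s)) := by
    simp only [Function.uncurry_def]
    exact (hm.comp continuous_snd).mul (by fun_prop)
  exact (this.stronglyMeasurable.integral_prod_right.measurable).const_mul _

lemma exp_mul_log_eq_rpow {y : ℝ} (hy : 0 < y) (p : ℝ) : Real.exp (p * Real.log y) = y ^ p := by
  rw [Real.rpow_def_of_pos hy, mul_comm]

/-- The kernel is `O(y ^ (ε - 1/2))`, and `ε > 0` is exactly what makes this square-integrable at 0.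
-/
lemma memLp_kernel (h : IsMellinMultiplier m ε q C) (x R : ℝ) (hR : 0 < R) :
    MemLp (fun y => logKernel m ε (Real.log x + Real.log y)) 2 (volume.restrict (Ioc 0 R)) := by
  set D := (2 * Real.pi)⁻¹ * (∫ τ : ℝ, ‖m (ε + τ * Complex.I)‖) * Real.exp ((ε - 1 / 2) * Real.log x)
  have hm : Measurable fun y => logKernel m ε (Real.log x + Real.log y) :=
    h.measurable_logKernel.comp (Real.measurable_log.const_add _)
  have hpow : MemLp (fun y : ℝ => y ^ (ε - 1 / 2)) 2 (volume.restrict (Ioc 0 R)) := by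
    rw [memLp_two_iff_integrable_sq (by fun_prop)]
    have h1 : IntervalIntegrable (fun y : ℝ => y ^ (2 * ε - 1)) volume 0 R :=
      intervalIntegral.intervalIntegrable_rpow' (by linarith [h.pos])
    rw [intervalIntegrable_iff_integrableOn_Ioc_of_le hR.le] at h1
    refine h1.congr ?_
    filter_upwards [ae_restrict_mem measurableSet_Ioc] with y hy
    rw [← Real.rpow_natCast, ← Real.rpow_mul hy.1.le]
    congr 1
    push_cast
    ring
  refine (hpow.const_mul D).mono hm.aestronglyMeasurable ?_
  filter_upwards [ae_restrict_mem measurableSet_Ioc] with y hy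
  refine (norm_logKernel_le m ε _).trans (le_trans (le_of_eq ?_) (le_abs_self _))
  rw [mul_add, Real.exp_add, exp_mul_log_eq_rpow hy.1]
  ring

/-- The integrand of the transform of the indicator function of `(0, exp α]` at `exp t`. -/
noncomputable def indicatorIntegrand (m : ℂ → ℂ) (t α : ℝ) (v : ℂ) : ℂ :=
  m v * Complex.exp ((v - 1 / 2) * t) * (Complex.exp ((v + 1 / 2) * α) / (v + 1 / 2))

lemma add_half_ne_zero {v : ℂ} (hv : 0 ≤ v.re) : v + 1 / 2 ≠ 0 := fun h0 => by
  have := congrArg Complex.re h0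
  simp at this
  linarith

lemma integral_Ioc_exp {v : ℂ} (hv : 0 ≤ v.re) (α : ℝ) :
    ∫ y in Ioc 0 (Real.exp α), Complex.exp ((v - 1 / 2) * Real.log y) =
      Complex.exp ((v + 1 / 2) * α) / (v + 1 / 2) := by
  have h1 : ∫ y in Ioc 0 (Real.exp α), Complex.exp ((v - 1 / 2) * Real.log y) =
      ∫ y in Ioc 0 (Real.exp α), (y : ℂ) ^ (v - 1 / 2) := by
    refine setIntegral_congr_fun measurableSet_Ioc fun y hy => ?_
    have : (y : ℂ) ≠ 0 := by exact_mod_cast hy.1.ne'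
    rw [Complex.cpow_def_of_ne_zero this, Complex.ofReal_log hy.1.le, mul_comm]
  have e : v - 1 / 2 + 1 = v + 1 / 2 := by ring
  have hexp : ((Real.exp α : ℝ) : ℂ) ≠ 0 := by exact_mod_cast (Real.exp_pos α).ne'
  rw [h1, ← intervalIntegral.integral_of_le (Real.exp_pos α).le,
    integral_cpow (Or.inl (by simp; linarith)), e, Complex.ofReal_zero, Complex.zero_cpow (add_half_ne_zero hv),
    sub_zero, Complex.cpow_def_of_ne_zero hexp, ← Complex.ofReal_log (Real.exp_pos α).le,
    Real.log_exp, mul_comm]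

/-- Fubini, justified by `q ε > 1`, which makes `m` integrable on the line `Re v = ε`. -/
lemma integral_Ioc_kernel (h : IsMellinMultiplier m ε q C) (t α : ℝ) :
    ∫ y in Ioc 0 (Real.exp α), logKernel m ε (t + Real.log y) =
      (2 * Real.pi : ℂ)⁻¹ * ∫ τ : ℝ, indicatorIntegrand m t α (ε + τ * Complex.I) := by
  simp only [logKernel]
  rw [integral_const_mul, integral_integral_swap]
  · congr 2
    ext τ
    rw [indicatorIntegrand, ← integral_Ioc_exp (by simpa using h.pos.le), ← integral_const_mul]
    congr 1
    ext y
    rw [Complex.ofReal_add, mul_add, Complex.exp_add]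
    ring
  · have h1 : Integrable (fun y : ℝ => Real.exp ((ε - 1 / 2) * (t + Real.log y)))
        (volume.restrict (Ioc 0 (Real.exp α))) := by
      have h2 : IntervalIntegrable (fun y : ℝ => y ^ (ε - 1 / 2)) volume 0 (Real.exp α) :=
        intervalIntegral.intervalIntegrable_rpow' (by linarith [h.pos])
      rw [intervalIntegrable_iff_integrableOn_Ioc_of_le (Real.exp_pos α).le] at h2
      refine (h2.const_mul (Real.exp ((ε - 1 / 2) * t))).congr ?_
      filter_upwards [ae_restrict_mem measurableSet_Ioc] with y hy
      rw [mul_add, Real.exp_add, exp_mul_log_eq_rpow hy.1]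
    have h3 := h1.mul_prod h.integrable_line.norm
    refine h3.mono' ?_ (Eventually.of_forall fun p => le_of_eq ?_)
    · have hm := h.continuous_vertical h.pos.le le_rfl
      refine Measurable.aestronglyMeasurable ?_
      simp only [Function.uncurry_def]
      exact (hm.measurable.comp measurable_snd).mul (by fun_prop)
    · simp only [Function.uncurry]
      rw [norm_mul, Complex.norm_exp, mul_comm]
      simp

lemma differentiableOn_indicatorIntegrand (h : IsMellinMultiplier m ε q C) (t α : ℝ) :
    DifferentiableOn ℂ (indicatorIntegrand m t α) {v | 0 ≤ v.re ∧ v.re ≤ ε} := by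
  refine (h.differentiableOn.mul (by fun_prop)).mul ?_
  exact DifferentiableOn.div (by fun_prop) (by fun_prop) fun v hv => add_half_ne_zero hv.1

lemma norm_exp_mul_exp_le {v : ℂ} (h0 : 0 ≤ v.re) (h1 : v.re ≤ ε) (t α : ℝ) :
    ‖Complex.exp ((v - 1 / 2) * t)‖ * ‖Complex.exp ((v + 1 / 2) * α)‖ ≤
      Real.exp ((ε + 1 / 2) * (|t| + |α|)) := by
  rw [Complex.norm_exp, Complex.norm_exp, ← Real.exp_add]
  apply Real.exp_le_exp.mpr
  simp
  have h2 : (v.re - 2⁻¹) * t ≤ (ε + 2⁻¹) * |t| := by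
    refine (le_abs_self _).trans ?_
    rw [abs_mul]
    gcongr
    rw [abs_le]
    constructor <;> linarith
  have h3 : (v.re + 2⁻¹) * α ≤ (ε + 2⁻¹) * |α| := by
    refine (le_abs_self _).trans ?_
    rw [abs_mul]
    gcongr
    rw [abs_le]
    constructor <;> linarith
  linarith

/-- The denominator `v + 1/2` gains one power of `|Im v|`, so the exponent `q u + 1` exceeds 1 for
every `u > 0`. This permits shifting the line arbitrarily close to the imaginary axis. -/
lemma norm_indicatorIntegrand_le (h : IsMellinMultiplier m ε q C) (t α : ℝ) {u : ℝ} (hu : 0 ≤ u)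
    {v : ℂ} (h0 : u ≤ v.re) (h1 : v.re ≤ ε) (him : 1 ≤ |v.im|) :
    ‖indicatorIntegrand m t α v‖ ≤
      C * Real.exp ((ε + 1 / 2) * (|t| + |α|)) * |v.im| ^ (-(q * u + 1)) := by
  have hpos : 0 < |v.im| := by linarith
  have hm : ‖m v‖ ≤ C * |v.im| ^ (-(q * u)) := by
    refine (h.norm_le_rpow v (hu.trans h0) h1 him).trans ?_
    have := h.nonneg
    have := h.q_pos.le
    gcongr
  have hd : |v.im| ≤ ‖v + 1 / 2‖ := by simpa using Complex.abs_im_le_norm (v + 1 / 2)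
  rw [indicatorIntegrand, norm_mul, norm_mul, norm_div]
  have hC := h.nonneg
  calc ‖m v‖ * ‖Complex.exp ((v - 1 / 2) * t)‖ * (‖Complex.exp ((v + 1 / 2) * α)‖ / ‖v + 1 / 2‖)
      = ‖m v‖ * (‖Complex.exp ((v - 1 / 2) * t)‖ * ‖Complex.exp ((v + 1 / 2) * α)‖) / ‖v + 1 / 2‖ := by
        ring
    _ ≤ (C * |v.im| ^ (-(q * u))) * Real.exp ((ε + 1 / 2) * (|t| + |α|)) / |v.im| := by
        gcongr
        exact norm_exp_mul_exp_le (hu.trans h0) h1 t α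
    _ = _ := by
        rw [neg_add, Real.rpow_add hpos, Real.rpow_neg_one]
        ring

lemma integral_Ioc_kernel_eq (h : IsMellinMultiplier m ε q C) (t α : ℝ) {u : ℝ} (hu : 0 < u)
    (hu' : u ≤ ε) :
    ∫ y in Ioc 0 (Real.exp α), logKernel m ε (t + Real.log y) =
      (2 * Real.pi : ℂ)⁻¹ * ∫ τ : ℝ, indicatorIntegrand m t α (u + τ * Complex.I) := by
  rw [h.integral_Ioc_kernel]
  congr 1
  have hq := h.q_pos
  refine integral_vertical_shift (p := q * u + 1)
    (C := C * Real.exp ((ε + 1 / 2) * (|t| + |α|))) (by nlinarith)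
    ((h.differentiableOn_indicatorIntegrand t α).mono fun v hv => ?_) fun v hv him => ?_
  · rw [mem_ofPred_eq, uIcc_of_le hu'] at hv
    exact ⟨hu.le.trans hv.1, hv.2⟩
  · rw [uIcc_of_le hu'] at hv
    exact h.norm_indicatorIntegrand_le t α hu.le hv.1 hv.2 him

/-- The Fourier side of the transform of the indicator function of `(0, exp α]`, on the line
`Re v = u`. -/
noncomputable def fourierSide (m : ℂ → ℂ) (α u : ℝ) (ξ : ℝ) : ℂ :=
  m (u + (2 * Real.pi * ξ : ℝ) * Complex.I) *
    (Complex.exp ((u + (2 * Real.pi * ξ : ℝ) * Complex.I + 1 / 2) * α) /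
      (u + (2 * Real.pi * ξ : ℝ) * Complex.I + 1 / 2))

lemma fourierSide_eq (m : ℂ → ℂ) (α u ξ : ℝ) : fourierSide m α u ξ =
    indicatorIntegrand m 0 α (u + (2 * Real.pi * ξ : ℝ) * Complex.I) := by
  simp [fourierSide, indicatorIntegrand]

lemma continuous_fourierSide (h : IsMellinMultiplier m ε q C) (α : ℝ) {u : ℝ} (h0 : 0 ≤ u)
    (h1 : u ≤ ε) : Continuous (fourierSide m α u) := by
  have : fourierSide m α u = fun ξ => indicatorIntegrand m 0 α
    (u + (2 * Real.pi * ξ : ℝ) * Complex.I) := funext fun ξ => fourierSide_eq m α u ξ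
  rw [this]
  exact (h.differentiableOn_indicatorIntegrand 0 α).continuousOn.comp_continuous (by fun_prop)
    fun ξ => by simpa using ⟨h0, h1⟩

lemma integrable_fourierSide (h : IsMellinMultiplier m ε q C) (α : ℝ) {u : ℝ} (h0 : 0 < u)
    (h1 : u ≤ ε) : Integrable (fourierSide m α u) := by
  have hq := h.q_pos
  have h2 : Integrable (fun τ : ℝ => indicatorIntegrand m 0 α (u + τ * Complex.I)) := by
    refine integrable_vertical (C := C * Real.exp ((ε + 1 / 2) * (|0| + |α|))) (p := q * u + 1)
      (by nlinarith) ((h.differentiableOn_indicatorIntegrand 0 α).continuousOn.mono ?_) fun t ht => ?_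
    · intro v hv
      have hv' : v.re = u := hv
      exact ⟨hv' ▸ h0.le, hv' ▸ h1⟩
    · simpa using h.norm_indicatorIntegrand_le 0 α h0.le (v := u + t * Complex.I) (by simp)
        (by simpa using h1) (by simpa using ht)
  have h3 := h2.comp_mul_left' (mul_pos two_pos Real.pi_pos).ne'
  exact h3.congr (Eventually.of_forall fun ξ => (fourierSide_eq m α u ξ).symm)

/-- A square-integrable majorant of `fourierSide`, uniform in `u`. -/
noncomputable def fourierBound (B ξ : ℝ) : ℝ := B * (√(1 + ξ ^ 2))⁻¹

lemma memLp_fourierBound (B : ℝ) : MemLp (fourierBound B) 2 := by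
  refine MemLp.const_mul ?_ B
  rw [memLp_two_iff_integrable_sq (by fun_prop)]
  refine integrable_inv_one_add_sq.congr (Eventually.of_forall fun ξ => ?_)
  simp only
  rw [inv_pow, Real.sq_sqrt (by positivity)]

/-- Rests on `(u + 1/2)² + (2πξ)² ≥ (1 + ξ²)/4`; uniformity in `u` is what dominated convergence
requires as `u → 0`. -/
lemma norm_fourierSide_le (h : IsMellinMultiplier m ε q C) (α : ℝ) {u : ℝ} (h0 : 0 ≤ u)
    (h1 : u ≤ ε) (ξ : ℝ) :
    ‖fourierSide m α u ξ‖ ≤ fourierBound (C * Real.exp ((ε + 1 / 2) * |α|) * 2) ξ := by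
  have hC := h.nonneg
  set v : ℂ := u + (2 * Real.pi * ξ : ℝ) * Complex.I with hv
  have hre : v.re = u := by simp [hv]
  have him : v.im = 2 * Real.pi * ξ := by simp [hv]
  have hd : √(1 + ξ ^ 2) / 2 ≤ ‖v + 1 / 2‖ := by
    rw [Complex.norm_def, div_le_iff₀ two_pos]
    refine Real.sqrt_le_iff.mpr ⟨by positivity, ?_⟩
    rw [mul_pow, Real.sq_sqrt (Complex.normSq_nonneg _), Complex.normSq_apply]
    simp [hre, him]
    have hpi : 1 ≤ Real.pi := by linarith [Real.pi_gt_three]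
    have hpi2 : 1 ≤ Real.pi ^ 2 := one_le_pow₀ hpi
    nlinarith [mul_nonneg (sub_nonneg.mpr hpi2) (sq_nonneg ξ), sq_nonneg ξ]
  have he := norm_exp_mul_exp_le (v := v) (ε := ε) (by rw [hre]; exact h0) (by rw [hre]; exact h1) 0 α
  simp only [Complex.ofReal_zero, mul_zero, Complex.exp_zero, norm_one, one_mul, abs_zero,
    zero_add] at he
  have hs : 0 < √(1 + ξ ^ 2) := Real.sqrt_pos.mpr (by positivity)
  rw [fourierSide, ← hv, norm_mul, norm_div, fourierBound]
  calc ‖m v‖ * (‖Complex.exp ((v + 1 / 2) * α)‖ / ‖v + 1 / 2‖)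
      ≤ C * (Real.exp ((ε + 1 / 2) * |α|) / (√(1 + ξ ^ 2) / 2)) := by
        gcongr
        exact h.norm_le v (by rw [hre]; exact h0) (by rw [hre]; exact h1)
    _ = _ := by field_simp

lemma memLp_fourierSide (h : IsMellinMultiplier m ε q C) (α : ℝ) {u : ℝ} (h0 : 0 ≤ u)
    (h1 : u ≤ ε) : MemLp (fourierSide m α u) 2 :=
  (memLp_fourierBound _).mono (h.continuous_fourierSide α h0 h1).aestronglyMeasurable
    (Eventually.of_forall fun ξ => (h.norm_fourierSide_le α h0 h1 ξ).trans (le_abs_self _))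

open FourierTransform

/-- The substitution `τ = 2πξ` in the shifted line integral. The factor `exp (-u t)` is the price of
leaving the critical line and tends to 1 as `u → 0`. -/
lemma fourierInv_fourierSide (h : IsMellinMultiplier m ε q C) (t α : ℝ) {u : ℝ} (h0 : 0 < u)
    (h1 : u ≤ ε) : 𝓕⁻ (fourierSide m α u) t = Complex.exp (-(u * t)) * (Complex.exp (t / 2) *
      ∫ y in Ioc 0 (Real.exp α), logKernel m ε (t + Real.log y)) := by
  rw [h.integral_Ioc_kernel_eq t α h0 h1, Real.fourierInv_eq']
  have hs := Measure.integral_comp_mul_left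
    (fun τ : ℝ => indicatorIntegrand m t α (u + τ * Complex.I)) (2 * Real.pi)
  have e : ((|(2 * Real.pi)⁻¹| : ℝ) : ℂ) = (2 * Real.pi : ℂ)⁻¹ := by
    rw [abs_of_pos (by positivity)]
    push_cast
    rfl
  rw [Complex.real_smul, e] at hs
  rw [← hs, ← integral_const_mul, ← integral_const_mul]
  congr 1
  ext ξ
  rw [fourierSide, indicatorIntegrand, smul_eq_mul]
  have e2 : Complex.exp (((2 * Real.pi * inner ℝ ξ t : ℝ) : ℂ) * Complex.I) =
      Complex.exp (-(u * t)) * (Complex.exp (t / 2) *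
        Complex.exp ((u + (2 * Real.pi * ξ : ℝ) * Complex.I - 1 / 2) * t)) := by
    rw [← Complex.exp_add, ← Complex.exp_add]
    congr 1
    simp
    ring
  rw [e2]
  ring

/-- The value of the inverse `L²` Fourier transform on the critical line. -/
lemma coeFn_fourierInv_fourierSide_zero (h : IsMellinMultiplier m ε q C) (α : ℝ) :
    ((𝓕⁻ ((h.memLp_fourierSide α le_rfl h.pos.le).toLp _) : Lp ℂ 2 (volume : Measure ℝ)) : ℝ → ℂ)
      =ᵐ[volume] fun t => Complex.exp (t / 2) *
        ∫ y in Ioc 0 (Real.exp α), logKernel m ε (t + Real.log y) := by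
  -- On the line `u = 0` the function decays only like `1/|ξ|`, so it is in `L²` but not in `L¹`; it
  -- is approached by lines on which the inversion integral converges absolutely.
  set u : ℕ → ℝ := fun n => ε / (n + 1) with hu
  have hu0 : ∀ n, 0 < u n := fun n => div_pos h.pos (by positivity)
  have hu1 : ∀ n, u n ≤ ε := fun n => div_le_self h.pos.le (by linarith [(n.cast_nonneg : (0 : ℝ) ≤ n)])
  have hulim : Tendsto u atTop (𝓝 0) := by
    have := (tendsto_one_div_add_atTop_nhds_zero_nat (𝕜 := ℝ)).const_mul ε
    rw [mul_zero] at this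
    refine this.congr fun n => ?_
    rw [hu, mul_one_div]
  have hlim : Tendsto (fun n => (h.memLp_fourierSide α (hu0 n).le (hu1 n)).toLp _) atTop
      (𝓝 ((h.memLp_fourierSide α le_rfl h.pos.le).toLp _)) := by
    rw [Lp.tendsto_Lp_iff_tendsto_eLpNorm'']
    refine tendsto_eLpNorm_two_of_dominated (memLp_fourierBound _)
      (fun n => (h.continuous_fourierSide α (hu0 n).le (hu1 n)).aestronglyMeasurable)
      (h.continuous_fourierSide α le_rfl h.pos.le).aestronglyMeasurable
      (fun n => Eventually.of_forall fun ξ => h.norm_fourierSide_le α (hu0 n).le (hu1 n) ξ)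
      (Eventually.of_forall fun ξ => h.norm_fourierSide_le α le_rfl h.pos.le ξ)
      (Eventually.of_forall fun ξ => ?_)
    simp only [fourierSide_eq]
    have hc := (h.differentiableOn_indicatorIntegrand 0 α).continuousOn
      (((0 : ℝ) : ℂ) + (2 * Real.pi * ξ : ℝ) * Complex.I) (by simpa using h.pos.le)
    refine hc.tendsto.comp (tendsto_nhdsWithin_iff.mpr ⟨?_, Eventually.of_forall fun n => ?_⟩)
    · exact ((Complex.continuous_ofReal.tendsto 0).comp hulim).add_const _
    · simpa using ⟨(hu0 n).le, hu1 n⟩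
  have hF : Tendsto (fun n => (𝓕⁻ ((h.memLp_fourierSide α (hu0 n).le (hu1 n)).toLp _) :
      Lp ℂ 2 (volume : Measure ℝ))) atTop
      (𝓝 (𝓕⁻ ((h.memLp_fourierSide α le_rfl h.pos.le).toLp _))) :=
    ((Lp.fourierTransformₗᵢ ℝ ℂ).symm.continuous.tendsto _).comp hlim
  obtain ⟨φ, hφ, hae⟩ := (tendstoInMeasure_of_tendsto_Lp hF).exists_seq_tendsto_ae
  filter_upwards [hae, ae_all_iff.mpr fun n => coeFn_fourierInv_toLp
    (h.integrable_fourierSide α (hu0 n) (hu1 n)) (h.memLp_fourierSide α (hu0 n).le (hu1 n))]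
    with t h1 h2
  refine tendsto_nhds_unique h1 ?_
  simp only [h2, h.fourierInv_fourierSide t α (hu0 _) (hu1 _)]
  have h3 : Tendsto (fun n => Complex.exp (-((u (φ n) : ℂ) * t))) atTop (𝓝 1) := by
    have hc : Continuous fun r : ℝ => Complex.exp (-((r : ℂ) * t)) := by fun_prop
    have := (hc.tendsto 0).comp (hulim.comp hφ.tendsto_atTop)
    simpa [Function.comp_def] using this
  simpa using h3.mul_const (Complex.exp (t / 2) *
    ∫ y in Ioc 0 (Real.exp α), logKernel m ε (t + Real.log y))

/-- The function `r ↦ exp (r / 2)` cut off at `α`. -/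
noncomputable def expCutoff (α r : ℝ) : ℂ := (Iic α).indicator (fun r : ℝ => (Real.exp (r / 2) : ℂ)) r

lemma integrable_expCutoff (α : ℝ) : Integrable (expCutoff α) := by
  refine (integrable_indicator_iff measurableSet_Iic).mpr ?_
  have := (integrableOn_exp_mul_Iic (a := 1 / 2) (by norm_num) α).ofReal (𝕜 := ℂ)
  refine this.congr (Eventually.of_forall fun r => ?_)
  simp only
  rw [show (1 : ℝ) / 2 * r = r / 2 by ring]
  rfl

lemma memLp_expCutoff (α : ℝ) : MemLp (expCutoff α) 2 := by
  refine (memLp_indicator_iff_restrict measurableSet_Iic).mpr ?_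
  rw [memLp_two_iff_integrable_sq_norm (by fun_prop)]
  refine (integrableOn_exp_mul_Iic (a := 1) (by norm_num) α).congr (Eventually.of_forall fun r => ?_)
  simp only
  rw [Complex.norm_real, Real.norm_of_nonneg (Real.exp_pos _).le, ← Real.exp_nat_mul]
  congr 1
  push_cast
  ring

lemma fourierInv_expCutoff (α ξ : ℝ) : 𝓕⁻ (expCutoff α) ξ =
    Complex.exp (((2 * Real.pi * ξ : ℝ) * Complex.I + 1 / 2) * α) /
      ((2 * Real.pi * ξ : ℝ) * Complex.I + 1 / 2) := by
  rw [Real.fourierInv_eq', ← integral_exp_mul_complex_Iic (by simp),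
    ← integral_indicator measurableSet_Iic]
  congr 1
  ext r
  by_cases hr : r ∈ Iic α
  · rw [expCutoff, indicator_of_mem hr, indicator_of_mem hr, smul_eq_mul, Complex.ofReal_exp,
      ← Complex.exp_add]
    congr 1
    simp
    ring
  · rw [expCutoff, indicator_of_notMem hr, indicator_of_notMem hr, smul_zero]

lemma logEquiv_indicatorIoc (α : ℝ) :
    logEquiv (indicatorIoc (Real.exp α)) = (memLp_expCutoff α).toLp _ := by
  apply Lp.ext
  filter_upwards [coeFn_logEquiv (indicatorIoc (Real.exp α)), (memLp_expCutoff α).coeFn_toLp,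
    isWeightedComp_exp.quasiMeasurePreserving.ae (coeFn_indicatorIoc (Real.exp α))] with t h1 h2 h3
  rw [h1, h2, h3, expCutoff]
  by_cases ht : t ∈ Iic α
  · rw [indicator_of_mem ht, indicator_of_mem (show Real.exp t ∈ Ioc 0 (Real.exp α) from
      ⟨Real.exp_pos t, Real.exp_le_exp.mpr ht⟩), mul_one]
  · rw [indicator_of_notMem ht, indicator_of_notMem fun h => ht (Real.exp_le_exp.mp h.2), mul_zero]

lemma measurable_imaginary (h : IsMellinMultiplier m ε q C) :
    Measurable fun ξ : ℝ => m ((2 * Real.pi * ξ : ℝ) * Complex.I) := by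
  have := (h.continuous_vertical le_rfl h.pos.le).measurable
  simp only [Complex.ofReal_zero, zero_add] at this
  exact this.comp (measurable_const_mul (2 * Real.pi))

/-- The unitary operator on `L²(ℝ₊)` defined by a Mellin multiplier. -/
noncomputable def transform (h : IsMellinMultiplier m ε q C) : L2Pos ≃ₗᵢ[ℂ] L2Pos :=
  -- Two inverse Fourier transforms, rather than a transform and its inverse, because the kernel
  -- depends on the sum `log x + log y` and not on the difference.
  logEquiv.trans <| (Lp.fourierTransformₗᵢ ℝ ℂ).symm.trans <|
    (unimodularMul volume h.measurable_imaginary fun ξ => h.norm_imaginary (2 * Real.pi * ξ)).trans <|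
      (Lp.fourierTransformₗᵢ ℝ ℂ).symm.trans logEquiv.symm

lemma logEquiv_transform_indicatorIoc (h : IsMellinMultiplier m ε q C) (α : ℝ) :
    logEquiv (h.transform (indicatorIoc (Real.exp α))) =
      𝓕⁻ ((h.memLp_fourierSide α le_rfl h.pos.le).toLp _) := by
  rw [transform]
  simp only [LinearIsometryEquiv.trans_apply, LinearIsometryEquiv.apply_symm_apply]
  change (Lp.fourierTransformₗᵢ ℝ ℂ).symm _ = (Lp.fourierTransformₗᵢ ℝ ℂ).symm _
  congr 1
  rw [logEquiv_indicatorIoc]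
  change unimodularMul _ _ _ (𝓕⁻ ((memLp_expCutoff α).toLp _)) = _
  apply Lp.ext
  filter_upwards [coeFn_unimodularMul h.measurable_imaginary
    (fun ξ => h.norm_imaginary (2 * Real.pi * ξ)) (𝓕⁻ ((memLp_expCutoff α).toLp _)),
    (h.memLp_fourierSide α le_rfl h.pos.le).coeFn_toLp,
    coeFn_fourierInv_toLp (integrable_expCutoff α) (memLp_expCutoff α)] with ξ h1 h2 h3
  rw [h1, h2, h3, fourierInv_expCutoff, fourierSide, Complex.ofReal_zero, zero_add]

/-- The operator defined by a Mellin multiplier is an integral transform. -/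
theorem isIntegralTransform (h : IsMellinMultiplier m ε q C) {k : ℝ → ℝ → ℂ}
    (hk : ∀ x > 0, ∀ y > 0, k x y = logKernel m ε (Real.log x + Real.log y)) :
    IsIntegralTransform k h.transform := by
  refine isIntegralTransform_of_indicatorIoc _ (fun x hx R hR => ?_) fun a ha => ?_
  · refine (memLp_congr_ae ?_).mp (h.memLp_kernel x R hR)
    filter_upwards [ae_restrict_mem measurableSet_Ioc] with y hy
    exact (hk x hx y hy.1).symm
  · obtain ⟨α, rfl⟩ : ∃ α, a = Real.exp α := ⟨Real.log a, (Real.exp_log ha).symm⟩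
    have h1 := h.coeFn_fourierInv_fourierSide_zero α
    rw [← h.logEquiv_transform_indicatorIoc] at h1
    have h2 : ∀ᵐ t : ℝ, h.transform (indicatorIoc (Real.exp α)) (Real.exp t) =
        ∫ y in Ioc 0 (Real.exp α), logKernel m ε (t + Real.log y) := by
      filter_upwards [h1, coeFn_logEquiv (h.transform (indicatorIoc (Real.exp α)))] with t h3 h4
      rw [h3] at h4
      have e : ((Real.exp (t / 2) : ℝ) : ℂ) = Complex.exp (t / 2) := by push_cast; rfl
      rw [e] at h4
      exact (mul_left_cancel₀ (Complex.exp_ne_zero _) h4).symm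
    -- The almost everywhere identity in `t` is pulled back along `t = log x`.
    filter_upwards [isWeightedComp_log.quasiMeasurePreserving.ae h2,
      ae_restrict_mem measurableSet_Ioi] with x h3 hx
    rw [Real.exp_log hx] at h3
    rw [h3]
    exact setIntegral_congr_fun measurableSet_Ioc fun y hy => (hk x hx y hy.1).symm

end IsMellinMultiplier

/-! ### The Gamma quotient as a Mellin multiplier. -/

/-- The quotient `Γ(β - w) / Γ(β + w)`. -/
noncomputable def gammaQuotient (β : ℝ) (w : ℂ) : ℂ :=
  Complex.Gamma (β - w) / Complex.Gamma (β + w)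

lemma norm_Gamma_sub_eq (β : ℝ) (w : ℂ) :
    ‖Complex.Gamma (β - w)‖ = ‖Complex.Gamma (β - starRingEnd ℂ w)‖ := by
  have : (β : ℂ) - starRingEnd ℂ w = starRingEnd ℂ (β - w) := by simp
  rw [this, Complex.Gamma_conj, Complex.norm_conj]

/-- For real `β` conjugation replaces `β - w` by `β - conj w`, which differs from `β + w` by the
real translation `2 Re w`; the growth estimate for `Γ` then applies. -/
lemma exists_norm_gammaQuotient_le (β U : ℝ) : ∃ C : ℝ, 0 < C ∧ ∀ w : ℂ, 0 ≤ w.re → w.re ≤ U →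
    1 ≤ |w.im| → ‖gammaQuotient β w‖ ≤ C * |w.im| ^ (-(2 * w.re)) := by
  obtain ⟨C, hC, h⟩ := exists_norm_Gamma_mul_rpow_le (β - U)
  refine ⟨C, hC, fun w h0 hU him => ?_⟩
  have hpos : 0 < |w.im| := by linarith
  have key := h (β - starRingEnd ℂ w) (by simp; linarith) (by simpa using him) (2 * w.re)
    (by linarith)
  have e : (β : ℂ) - starRingEnd ℂ w + (2 * w.re : ℝ) = β + w := by
    apply Complex.ext <;> simp
    ring
  have e2 : |((β : ℂ) - starRingEnd ℂ w).im| = |w.im| := by simp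
  rw [e, e2, ← norm_Gamma_sub_eq] at key
  rw [gammaQuotient, norm_div]
  have hp : 0 < |w.im| ^ (2 * w.re) := Real.rpow_pos_of_pos hpos _
  refine div_le_of_le_mul₀ (norm_nonneg _) (by positivity) ?_
  rw [Real.rpow_neg hpos.le, ← div_eq_mul_inv, div_mul_eq_mul_div, le_div_iff₀ hp]
  exact key

lemma differentiableAt_gammaQuotient {β : ℝ} {w : ℂ} (h : w.re < β ∨ w.im ≠ 0) :
    DifferentiableAt ℂ (gammaQuotient β) w := by
  have h1 : DifferentiableAt ℂ Complex.Gamma (β - w) := by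
    refine Complex.differentiableAt_Gamma _ fun n hn => ?_
    rcases h with h | h
    · have := congrArg Complex.re hn
      simp at this
      linarith [(n.cast_nonneg : (0 : ℝ) ≤ n)]
    · have := congrArg Complex.im hn
      simp at this
      exact h this
  have h2 : DifferentiableAt ℂ (fun w => Complex.Gamma (β - w)) w :=
    DifferentiableAt.comp w h1 (by fun_prop)
  have h3 : DifferentiableAt ℂ (fun w : ℂ => (Complex.Gamma (β + w))⁻¹) w :=
    (Complex.differentiable_one_div_Gamma (β + w)).comp w
      (f := fun w : ℂ => (β : ℂ) + w) (by fun_prop)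
  exact h2.mul h3

lemma norm_gammaQuotient_imaginary {β : ℝ} (hβ : 0 < β) (t : ℝ) :
    ‖gammaQuotient β (t * Complex.I)‖ = 1 := by
  have e : (β : ℂ) - starRingEnd ℂ (t * Complex.I) = β + t * Complex.I := by simp
  rw [gammaQuotient, norm_div, norm_Gamma_sub_eq, e]
  refine div_self (norm_ne_zero_iff.mpr (Complex.Gamma_ne_zero_of_re_pos ?_))
  simpa using hβ

/-- The product `Γ(β₁ - w) Γ(β₂ - w) / (Γ(β₁ + w) Γ(β₂ + w))`. -/
noncomputable def gammaSymbol (β₁ β₂ : ℝ) (w : ℂ) : ℂ := gammaQuotient β₁ w * gammaQuotient β₂ w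

lemma exists_norm_gammaSymbol_le (β₁ β₂ U : ℝ) : ∃ C : ℝ, 0 < C ∧ ∀ w : ℂ, 0 ≤ w.re → w.re ≤ U →
    1 ≤ |w.im| → ‖gammaSymbol β₁ β₂ w‖ ≤ C * |w.im| ^ (-(4 * w.re)) := by
  obtain ⟨C₁, hC₁, h₁⟩ := exists_norm_gammaQuotient_le β₁ U
  obtain ⟨C₂, hC₂, h₂⟩ := exists_norm_gammaQuotient_le β₂ U
  refine ⟨C₁ * C₂, by positivity, fun w h0 hU him => ?_⟩
  have hpos : 0 < |w.im| := by linarith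
  rw [gammaSymbol, norm_mul]
  calc _ ≤ (C₁ * |w.im| ^ (-(2 * w.re))) * (C₂ * |w.im| ^ (-(2 * w.re))) :=
        mul_le_mul (h₁ w h0 hU him) (h₂ w h0 hU him) (norm_nonneg _) (by positivity)
    _ = C₁ * C₂ * (|w.im| ^ (-(2 * w.re)) * |w.im| ^ (-(2 * w.re))) := by ring
    _ = _ := by
        rw [← Real.rpow_add hpos]
        congr 2
        ring

lemma differentiableAt_gammaSymbol {β₁ β₂ : ℝ} {w : ℂ} (h : w.re < β₁ ∧ w.re < β₂ ∨ w.im ≠ 0) :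
    DifferentiableAt ℂ (gammaSymbol β₁ β₂) w :=
  (differentiableAt_gammaQuotient (h.imp_left And.left)).mul
    (differentiableAt_gammaQuotient (h.imp_left And.right))

/-- The abscissa 3/8 for `w = γ v` lies below 1/2, hence left of all poles, and above 1/4, so that
the decay exponent `4 · 3/8 = 3/2` exceeds 1. -/
lemma exists_isMellinMultiplier {β₁ β₂ γ : ℝ} (h₁ : 1 / 2 ≤ β₁) (h₂ : 1 / 2 ≤ β₂) (hγ : 1 ≤ γ) :
    ∃ C, IsMellinMultiplier (fun v => gammaSymbol β₁ β₂ (γ * v)) (3 / 8 / γ) (4 * γ) C := by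
  have hγ0 : 0 < γ := by linarith
  obtain ⟨C, hC, h⟩ := exists_norm_gammaSymbol_le β₁ β₂ (3 / 8)
  have hre : ∀ v : ℂ, ((γ : ℂ) * v).re = γ * v.re := fun v => by simp
  have him : ∀ v : ℂ, ((γ : ℂ) * v).im = γ * v.im := fun v => by simp
  have hle : ∀ {v : ℂ}, v.re ≤ 3 / 8 / γ → ((γ : ℂ) * v).re ≤ 3 / 8 := fun {v} hv => by
    rw [hre, mul_comm]
    exact (le_div_iff₀ hγ0).mp hv
  have hdiff : DifferentiableOn ℂ (fun v => gammaSymbol β₁ β₂ (γ * v))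
      {v | 0 ≤ v.re ∧ v.re ≤ 3 / 8 / γ} := by
    intro v hv
    have hlt := hle hv.2
    refine DifferentiableAt.differentiableWithinAt ?_
    exact (differentiableAt_gammaSymbol (Or.inl ⟨by linarith, by linarith⟩)).comp v
      (f := fun v : ℂ => (γ : ℂ) * v) (by fun_prop)
  have hdecay : ∀ v : ℂ, 0 ≤ v.re → v.re ≤ 3 / 8 / γ → 1 ≤ |v.im| →
      ‖gammaSymbol β₁ β₂ (γ * v)‖ ≤ C * |v.im| ^ (-(4 * γ * v.re)) := by
    intro v h0 hU h1
    -- Here `γ ≥ 1` lets decay in `|Im (γ v)|` be weakened to decay in `|Im v|`.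
    have hge : |v.im| ≤ |((γ : ℂ) * v).im| := by
      rw [him, abs_mul, abs_of_pos hγ0]
      exact le_mul_of_one_le_left (abs_nonneg _) hγ
    refine (h _ (by rw [hre]; positivity) (hle hU) (h1.trans hge)).trans ?_
    rw [hre, ← mul_assoc]
    gcongr C * ?_
    exact Real.rpow_le_rpow_of_nonpos (by linarith) hge (by
      have : 0 ≤ 4 * γ * v.re := by positivity
      linarith)
  have hcpt : IsCompact (Icc (0 : ℝ) (3 / 8 / γ) ×ℂ Icc (-1 : ℝ) 1) :=
    isCompact_Icc.reProdIm isCompact_Icc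
  obtain ⟨B, hB⟩ := hcpt.exists_bound_of_continuousOn (hdiff.continuousOn.mono fun v hv => by
    exact ⟨hv.1.1, hv.1.2⟩)
  have hCle : C ≤ max C B := le_max_left _ _
  refine ⟨max C B, ⟨by positivity, ?_, hdiff, fun v h0 hU => ?_, fun v h0 hU h1 => ?_, fun t => ?_⟩⟩
  · rw [show 4 * γ * (3 / 8 / γ) = 3 / 2 by field_simp; norm_num]
    norm_num
  · rcases le_total |v.im| 1 with h1 | h1
    · exact (hB v ⟨⟨h0, hU⟩, abs_le.mp h1⟩).trans (le_max_right _ _)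
    · refine (hdecay v h0 hU h1).trans (le_trans ?_ hCle)
      refine mul_le_of_le_one_right hC.le (Real.rpow_le_one_of_one_le_of_nonpos h1 ?_)
      have : 0 ≤ 4 * γ * v.re := by positivity
      linarith
  · refine (hdecay v h0 hU h1).trans ?_
    gcongr
  · have e : (γ : ℂ) * (t * Complex.I) = (γ * t : ℝ) * Complex.I := by push_cast; ring
    rw [e, gammaSymbol, norm_mul, norm_gammaQuotient_imaginary (by linarith),
      norm_gammaQuotient_imaginary (by linarith), one_mul]

/-! ### Meijer's function as the kernel of the multiplier. -/

lemma meijerIntegrand_eq (b₁ b₂ γ X : ℝ) (z : ℂ) :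
    meijerIntegrand b₁ b₂ (1 - γ - b₁) (1 - γ - b₂) X z =
      gammaSymbol (b₁ + γ / 2) (b₂ + γ / 2) (z + γ / 2) * (X : ℂ) ^ z := by
  have e1 : ∀ b : ℝ, ((b + γ / 2 : ℝ) : ℂ) - (z + γ / 2) = b - z := fun b => by push_cast; ring
  have e2 : ∀ b : ℝ, ((b + γ / 2 : ℝ) : ℂ) + (z + γ / 2) = 1 - (1 - γ - b) + z := fun b => by
    push_cast; ring
  rw [meijerIntegrand, gammaSymbol, gammaQuotient, gammaQuotient, e1, e1, e2, e2, div_mul_div_comm]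

lemma norm_ofReal_cpow_le {X : ℝ} (hX : 0 < X) {z : ℂ} {d c : ℝ} (hz : z.re ∈ uIcc d c) :
    ‖(X : ℂ) ^ z‖ ≤ Real.exp (|Real.log X| * (|d| + |c|)) := by
  rw [Complex.norm_cpow_eq_rpow_re_of_pos hX, Real.rpow_def_of_pos hX]
  apply Real.exp_le_exp.mpr
  refine (le_abs_self _).trans ?_
  rw [abs_mul]
  gcongr
  rw [mem_uIcc] at hz
  have h1 := neg_abs_le d
  have h2 := le_abs_self d
  have h3 := neg_abs_le c
  have h4 := le_abs_self c
  rw [abs_le]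
  rcases hz with hz | hz <;> constructor <;> linarith [hz.1, hz.2, abs_nonneg c, abs_nonneg d]

lemma meijerG_eq_integral {b₁ b₂ γ : ℝ} (h₁ : 1 / 2 ≤ b₁ + γ / 2) (h₂ : 1 / 2 ≤ b₂ + γ / 2)
    (L : MeijerContour (b₁ : ℂ) (b₂ : ℂ) (1 - γ - b₁ : ℂ) (1 - γ - b₂ : ℂ)) {X : ℝ} (hX : 0 < X) :
    meijerG L X = (2 * Real.pi : ℂ)⁻¹ * ∫ t : ℝ,
      gammaSymbol (b₁ + γ / 2) (b₂ + γ / 2) ((3 / 8 : ℝ) + t * Complex.I) *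
        (X : ℂ) ^ (((3 / 8 - γ / 2 : ℝ) : ℂ) + t * Complex.I) := by
  have hX0 : (X : ℂ) ≠ 0 := by exact_mod_cast hX.ne'
  have hc := L.lt_c
  have hs₁ := L.s_lt₁
  have hs₂ := L.s_lt₂
  simp only [Complex.add_re, Complex.sub_re, Complex.one_re, Complex.ofReal_re] at hc hs₁ hs₂
  -- The line `Re z = d` is `Re w = 3/8` for `w = z + γ/2`; it lies left of both `b₁` and `b₂`.
  set d : ℝ := 3 / 8 - γ / 2 with hd
  obtain ⟨C, hC, hdecay⟩ := exists_norm_gammaSymbol_le (b₁ + γ / 2) (b₂ + γ / 2)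
    (max d L.c + γ / 2)
  have hF : meijerIntegrand b₁ b₂ (1 - γ - b₁) (1 - γ - b₂) X = fun z =>
      gammaSymbol (b₁ + γ / 2) (b₂ + γ / 2) (z + γ / 2) * (X : ℂ) ^ z :=
    funext (meijerIntegrand_eq b₁ b₂ γ X)
  have hre : ∀ z : ℂ, (z + γ / 2).re = z.re + γ / 2 := fun z => by simp
  have him : ∀ z : ℂ, (z + γ / 2).im = z.im := fun z => by simp
  have hdiff : ∀ z : ℂ, (z.re < b₁ ∧ z.re < b₂ ∨ z.im ≠ 0) → DifferentiableAt ℂ (fun z : ℂ =>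
      gammaSymbol (b₁ + γ / 2) (b₂ + γ / 2) (z + γ / 2) * (X : ℂ) ^ z) z := by
    intro z hz
    have h3 : DifferentiableAt ℂ (gammaSymbol (b₁ + γ / 2) (b₂ + γ / 2)) (z + γ / 2) := by
      refine differentiableAt_gammaSymbol ?_
      rw [hre, him]
      exact hz.imp_left fun h => ⟨by linarith [h.1], by linarith [h.2]⟩
    have h4 : DifferentiableAt ℂ (fun z : ℂ => gammaSymbol (b₁ + γ / 2) (b₂ + γ / 2) (z + γ / 2)) z :=
      h3.comp z (f := fun z : ℂ => z + γ / 2) (by fun_prop)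
    exact h4.mul (differentiableAt_id.const_cpow (Or.inl hX0))
  -- The four parameters sum to `2 - 2γ`, so the convergence condition on `c` says exactly that the
  -- decay exponent `4 (c + γ/2)` exceeds 1.
  have hmin : 1 < 4 * (min d L.c + γ / 2) := by
    rcases min_cases d L.c with h | h <;> rw [h.1] <;> linarith
  rw [meijerG, hF, L.integral_eq_vertical (d := d) (p := 4 * (min d L.c + γ / 2))
    (C := C * Real.exp (|Real.log X| * (|d| + |L.c|))) hmin]
  · have e : ∀ t : ℝ, ((d : ℂ) + t * Complex.I + γ / 2) = (3 / 8 : ℝ) + t * Complex.I := fun t => by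
      rw [hd]; push_cast; ring
    simp only [e]
    rw [← mul_assoc]
    congr 1
    field_simp
  · intro z hz
    rw [mem_ofPred_eq, mem_uIcc] at hz
    refine (hdiff z (Or.inl ?_)).differentiableWithinAt
    rcases hz with hz | hz <;> constructor <;> linarith [hz.1, hz.2]
  · exact fun z hz => (hdiff z (Or.inr hz)).differentiableWithinAt
  · intro z hz h1
    have hz' : min d L.c ≤ z.re ∧ z.re ≤ max d L.c := hz
    have hpos : 0 < |z.im| := by linarith
    have h5 := hdecay (z + γ / 2) (by rw [hre]; linarith [hz'.1]) (by rw [hre]; linarith [hz'.2])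
      (by rw [him]; exact h1)
    rw [hre, him] at h5
    rw [norm_mul]
    have h6 : |z.im| ^ (-(4 * (z.re + γ / 2))) ≤ |z.im| ^ (-(4 * (min d L.c + γ / 2))) :=
      Real.rpow_le_rpow_of_exponent_le h1 (by linarith [hz'.1])
    calc _ ≤ C * |z.im| ^ (-(4 * (min d L.c + γ / 2))) *
          Real.exp (|Real.log X| * (|d| + |L.c|)) := by
          refine mul_le_mul (h5.trans ?_) (norm_ofReal_cpow_le hX hz) (norm_nonneg _) (by positivity)
          gcongr
      _ = _ := by ring

/-- The substitution `t = γ τ` absorbs the factor `1/γ`, and with `z = γ v - γ/2` the power `((xy) ^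
(1/γ)) ^ z` becomes `(xy) ^ (v - 1/2)`. -/
lemma meijerKernel_eq_logKernel {b₁ b₂ γ : ℝ} (hγ : 0 < γ) (h₁ : 1 / 2 ≤ b₁ + γ / 2)
    (h₂ : 1 / 2 ≤ b₂ + γ / 2)
    (L : MeijerContour (b₁ : ℂ) (b₂ : ℂ) (1 - γ - b₁ : ℂ) (1 - γ - b₂ : ℂ)) {x y : ℝ} (hx : 0 < x)
    (hy : 0 < y) :
    (1 / γ : ℂ) * meijerG L ((x * y) ^ (1 / γ)) =
      logKernel (fun v => gammaSymbol (b₁ + γ / 2) (b₂ + γ / 2) (γ * v)) (3 / 8 / γ)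
        (Real.log x + Real.log y) := by
  have hX : 0 < (x * y) ^ (1 / γ) := by positivity
  have hX0 : (((x * y) ^ (1 / γ) : ℝ) : ℂ) ≠ 0 := by exact_mod_cast hX.ne'
  have hγ0 : (γ : ℂ) ≠ 0 := by exact_mod_cast hγ.ne'
  have hs := Measure.integral_comp_mul_left (fun t : ℝ =>
    gammaSymbol (b₁ + γ / 2) (b₂ + γ / 2) ((3 / 8 : ℝ) + t * Complex.I) *
      (((x * y) ^ (1 / γ) : ℝ) : ℂ) ^ (((3 / 8 - γ / 2 : ℝ) : ℂ) + t * Complex.I)) γ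
  rw [Complex.real_smul, abs_of_pos (inv_pos.mpr hγ), Complex.ofReal_inv] at hs
  rw [meijerG_eq_integral h₁ h₂ L hX, logKernel, mul_left_comm, one_div (γ : ℂ), ← hs]
  congr 2
  ext τ
  rw [Complex.cpow_def_of_ne_zero hX0, ← Complex.ofReal_log hX.le, Real.log_rpow (by positivity),
    Real.log_mul hx.ne' hy.ne']
  congr 2
  · push_cast
    field_simp
  · push_cast
    field_simp
    ring

theorem mainTheorem4 (b₁ b₂ γ : ℝ)
    (hb₁ : ∃ m : ℤ, b₁ = m / 2) (hb₂ : ∃ m : ℤ, b₂ = m / 2) (hγ : ∃ m : ℤ, γ = m / 2)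
    (hb₁0 : 0 ≤ b₁) (hγ1 : 1 ≤ γ) (hb₂l : (1 - γ) / 2 ≤ b₂) (hb₂u : b₂ ≤ 1 / 2 + b₁)
    (L : MeijerContour (b₁ : ℂ) (b₂ : ℂ) (1 - γ - b₁ : ℂ) (1 - γ - b₂ : ℂ)) :
    ∃ S : L2Pos ≃ₗᵢ[ℂ] L2Pos,
      IsIntegralTransform (fun x y => (1 / γ : ℂ) * meijerG L ((x * y) ^ (1 / γ))) S ∧
      ∀ f : L2Pos, ‖S f‖ = ‖f‖ := by
  have h₁ : 1 / 2 ≤ b₁ + γ / 2 := by linarith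
  have h₂ : 1 / 2 ≤ b₂ + γ / 2 := by linarith
  obtain ⟨C, h⟩ := exists_isMellinMultiplier h₁ h₂ hγ1
  exact ⟨h.transform, h.isIntegralTransform fun x hx y hy =>
    meijerKernel_eq_logKernel (by linarith) h₁ h₂ L hx hy, h.transform.norm_map⟩
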